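/- Let $R$ and $S$ be associative rings with unit; modules are left modules, and right $R$-modules are left modules over $R^{op}$. Let $n,d$ be integers with $d\ge 1$ and $n>d+1$. A module $U$ is \emph{finitely $n$-presented} if there is an exact sequence $F_n\to\cdots\to F_1\to F_0\to U\to 0$ with every $F_i$ finitely generated and free. An $S$-module $I$ is \emph{$(n,d)$-injective} if $\mathrm{Ext}_S^{d+1}(U,I)=0$ for every finitely $n$-presented $S$-module $U$; an $R$-module $F$ is \emph{$(n,d)$-flat} if $\mathrm{Tor}^R_{d+1}(U,F)=0$ for every finitely $n$-presented right $R$-module $U$. An $(S,R)$-bimodule $K$ is \emph{semidualizing} if ${}_SK$ and $K_R$ both have resolutions by finitely generated projective modules, the homothety maps $S\to\mathrm{Hom}_{R^{op}}(K,K)$ and $R\to\mathrm{Hom}_S(K,K)$ are bijective, and $\mathrm{Ext}_S^i(K,K)=0=\mathrm{Ext}_{R^{op}}^i(K,K)$ for all $i\ge1$. Let $C$ be an $(S,R)$-bimodule that is super finitely presented, i.e. both ${}_SC$ and $C_R$ have resolutions $\cdots\to F_1\to F_0\to C\to0$ by finitely generated free modules. Let $K_{d-1}$ be a special semidualizing bimodule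 with respect to $C$: a semidualizing $(S,R)$-bimodule that is a $(d-1)$th syzygy of $C$ on both sides, i.e. as a left $S$-module (respectively as a right $R$-module) it is isomorphic to $\mathrm{Ker}(F_{d-1}\to F_{d-2})$, where $F_{-1}=C$, for some such resolution of ${}_SC$ (respectively of $C_R$). (This holds in particular if $K_{d-1}$ is the $(d-1)$th syzygy in an exact sequence of bimodules $\cdots\to F_1\to F_0\to C\to 0$ whose terms $F_i$ are finitely generated and free both as left $S$-modules and as right $R$-modules.) Let $\mathcal I^{(n,d)}_{K_{d-1}}(R)$ be the class of all $R$-modules isomorphic to $\mathrm{Hom}_S(K_{d-1},I)$ for some $(n,d)$-injective $S$-module $I$, and let $\mathcal F^{(n,d)}_{K_{d-1}}(S)$ be the class of all $S$-modules isomorphic to $K_{d-1}\otimes_RF$ for some $(n,d)$-flat $R$-module $F$. Let $J$ be any set. \textbf{Proposition.} (a) For every family $(M_j)_{j\in J}$ of $R$-modules the following are equivalent: (1) $M_j\in\mathcal I^{(n,d)}_{K_{d-1}}(R)$ for every $j\in J$; (2) $\prod_{j\in J}M_j\in\mathcal I^{(n,d)}_{K_{d-1}}(R)$; (3) $\bigoplus_{j\in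 J}M_j\in\mathcal I^{(n,d)}_{K_{d-1}}(R)$. (b) For every family $(M_j)_{j\in J}$ of $S$-modules the following are equivalent: (1) $M_j\in\mathcal F^{(n,d)}_{K_{d-1}}(S)$ for every $j\in J$; (2) $\prod_{j\in J}M_j\in\mathcal F^{(n,d)}_{K_{d-1}}(S)$; (3) $\bigoplus_{j\in J}M_j\in\mathcal F^{(n,d)}_{K_{d-1}}(S)$. -/

import Mathlib

open CategoryTheory

open scoped TensorProduct DirectSum

universe u

noncomputable section

namespace SpecialSemidualizing

/-! ### Hom and tensor product over noncommutative rings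

A right `R`-module is a module over `Rᵐᵒᵖ`; an `(S, R)`-bimodule is a type with commuting structures
of `S`-module and `Rᵐᵒᵖ`-module. -/

section HomModule

variable (S R K I : Type u) [Ring S] [Ring R]
  [AddCommGroup K] [Module S K] [Module Rᵐᵒᵖ K] [SMulCommClass S Rᵐᵒᵖ K]
  [AddCommGroup I] [Module S I]

/-- `Hom_S(K, I)` for an `(S, R)`-bimodule `K` and a left `S`-module `I`, with the left `R`-module
structure `(r • f) x = f (x r)` below. -/
def BimodHom : Type u := K →ₗ[S] I

instance : AddCommGroup (BimodHom S K I) := inferInstanceAs (AddCommGroup (K →ₗ[S] I))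

instance : Module R (BimodHom S K I) where
  smul r f :=
    { toFun := fun x => (show K →ₗ[S] I from f) (MulOpposite.op r • x)
      map_add' := fun x y => by rw [smul_add, map_add]
      map_smul' := fun s x => by rw [← smul_comm s (MulOpposite.op r) x, map_smul]; rfl }
  one_smul f := LinearMap.ext fun x => congrArg (show K →ₗ[S] I from f) (one_smul Rᵐᵒᵖ x)
  mul_smul r r' f := LinearMap.ext fun x =>
    congrArg (show K →ₗ[S] I from f) (mul_smul (MulOpposite.op r') (MulOpposite.op r) x)
  smul_zero r := LinearMap.ext fun _ => rfl
  smul_add r f g := LinearMap.ext fun _ => rfl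
  add_smul r r' f := LinearMap.ext fun x =>
    (congrArg (show K →ₗ[S] I from f)
      (add_smul (MulOpposite.op r) (MulOpposite.op r') x)).trans
      (map_add (show K →ₗ[S] I from f) _ _)
  zero_smul f := LinearMap.ext fun x =>
    (congrArg (show K →ₗ[S] I from f) (zero_smul Rᵐᵒᵖ x)).trans
      (map_zero (show K →ₗ[S] I from f))

end HomModule

section Tensor

/-- The submodule of `K ⊗[ℤ] F` generated by the elements `(x r) ⊗ y - x ⊗ (r y)`. For a
`(T, R)`-bimodule `K` the set of generators is stable under `T`, so that the `T`-span is the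
additive subgroup that they generate. -/
def balancedRel (T : Type*) (R K F : Type u) [Ring T] [Ring R] [AddCommGroup K] [Module T K]
    [Module Rᵐᵒᵖ K] [AddCommGroup F] [Module R F] : Submodule T (K ⊗[ℤ] F) :=
  Submodule.span T
    {z | ∃ (x : K) (r : R) (y : F), z = (MulOpposite.op r • x) ⊗ₜ[ℤ] y - x ⊗ₜ[ℤ] (r • y)}

/-- The tensor product `K ⊗_R F` of a right `R`-module `K` and a left `R`-module `F`, as a left
`T`-module for a `(T, R)`-bimodule `K` (`T = ℤ` gives the bare abelian group). -/
abbrev BalTensor (T : Type*) (R K F : Type u) [Ring T] [Ring R] [AddCommGroup K] [Module T K]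
    [Module Rᵐᵒᵖ K] [AddCommGroup F] [Module R F] : Type u :=
  (K ⊗[ℤ] F) ⧸ balancedRel T R K F

end Tensor

section Tor

variable (R U : Type u) [Ring R] [AddCommGroup U] [Module Rᵐᵒᵖ U]

/-- The map `U ⊗_R F → U ⊗_R G` induced by an `R`-linear map `F → G`. -/
def balTensorMap {F G : Type u} [AddCommGroup F] [Module R F] [AddCommGroup G] [Module R G]
    (f : F →ₗ[R] G) : BalTensor ℤ R U F →ₗ[ℤ] BalTensor ℤ R U G :=
  Submodule.mapQ _ _ (LinearMap.lTensor U (f.toAddMonoidHom.toIntLinearMap)) (by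
    rw [balancedRel, Submodule.span_le]
    rintro _ ⟨x, r, y, rfl⟩
    refine Submodule.subset_span ⟨x, r, f y, ?_⟩
    simp)

theorem balTensorMap_add {F G : Type u} [AddCommGroup F] [Module R F] [AddCommGroup G] [Module R G]
    (f g : F →ₗ[R] G) : balTensorMap R U (f + g) = balTensorMap R U f + balTensorMap R U g := by
  refine Submodule.linearMap_qext _ (TensorProduct.ext' fun x y => ?_)
  simp [balTensorMap, TensorProduct.tmul_add]

/-- The functor `U ⊗_R -` from left `R`-modules to abelian groups. -/
def tensorFunctor : ModuleCat.{u} R ⥤ ModuleCat.{u} ℤ where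
  obj F := ModuleCat.of ℤ (BalTensor ℤ R U F)
  map f := ModuleCat.ofHom (balTensorMap R U f.hom)
  map_id F := by
    ext : 1
    refine Submodule.linearMap_qext _ (TensorProduct.ext' fun x y => ?_)
    simp [balTensorMap]
  map_comp f g := by
    ext : 1
    refine Submodule.linearMap_qext _ (TensorProduct.ext' fun x y => ?_)
    simp [balTensorMap]

instance : (tensorFunctor R U).Additive where
  map_add {F G f g} := by
    ext : 1
    exact balTensorMap_add R U f.hom g.hom

/-- `Tor_i^R(U, N)` for a right `R`-module `U` and a left `R`-module `N`: the `i`-th left derived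
functor of `U ⊗_R -`, evaluated at `N`. -/
def Tor (N : Type u) [AddCommGroup N] [Module R N] (i : ℕ) : Type u :=
  ((tensorFunctor R U).leftDerived i).obj (ModuleCat.of R N)

end Tor

/-! ### Finiteness conditions and syzygies -/

section Finiteness

variable (T : Type u) [Ring T]

/-- `U` is finitely `n`-presented: there is an exact sequence `F_n → ⋯ → F_1 → F_0 → U → 0` with
each `F_i = T ^ (rank i)`. The maps `diff i : F_{i+1} → F_i` with `i ≥ n` play no role. -/
def IsFinitelyNPresented (n : ℕ) (U : Type u) [AddCommGroup U] [Module T U] : Prop :=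
  ∃ (rank : ℕ → ℕ) (aug : (Fin (rank 0) → T) →ₗ[T] U)
    (diff : ∀ i, (Fin (rank (i + 1)) → T) →ₗ[T] (Fin (rank i) → T)),
    Function.Surjective aug ∧ (0 < n → Function.Exact (diff 0) aug) ∧
      ∀ i, i + 1 < n → Function.Exact (diff (i + 1)) (diff i)

/-- An exact sequence `⋯ → F_2 → F_1 → F_0 → U → 0` with each `F_i = T ^ (rank i)` finitely
generated and free. A module is super finitely presented if it has such a resolution. -/
structure FiniteFreeResolution (U : Type u) [AddCommGroup U] [Module T U] where
  rank : ℕ → ℕ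
  aug : (Fin (rank 0) → T) →ₗ[T] U
  diff : ∀ i, (Fin (rank (i + 1)) → T) →ₗ[T] (Fin (rank i) → T)
  aug_surjective : Function.Surjective aug
  exact_zero : Function.Exact (diff 0) aug
  exact_succ : ∀ i, Function.Exact (diff (i + 1)) (diff i)

/-- The `m`-th syzygy `K_m = Ker (F_m → F_{m-1})` of a resolution, where `F_{-1} = U`. -/
def FiniteFreeResolution.syzygy {T : Type u} [Ring T] {U : Type u} [AddCommGroup U] [Module T U]
    (P : FiniteFreeResolution T U) : ∀ m : ℕ, Submodule T (Fin (P.rank m) → T)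
  | 0 => LinearMap.ker P.aug
  | m + 1 => LinearMap.ker (P.diff m)

/-- `K` is a `(d-1)`-th syzygy of the super finitely presented module `U`, where the `(-1)`-st
syzygy is `U` itself. -/
def IsPredSyzygy (U K : Type u) [AddCommGroup U] [Module T U] [AddCommGroup K] [Module T K] :
    ℕ → Prop
  | 0 => Nonempty (FiniteFreeResolution T U) ∧ Nonempty (K ≃ₗ[T] U)
  | m + 1 => ∃ P : FiniteFreeResolution T U, Nonempty (K ≃ₗ[T] P.syzygy m)

/-- `U` has a degreewise finite projective resolution. -/
def HasFiniteProjectiveResolution (U : Type u) [AddCommGroup U] [Module T U] : Prop :=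
  ∃ P : ProjectiveResolution (ModuleCat.of T U), ∀ i, Module.Finite T (P.complex.X i)

end Finiteness

/-! ### `(n, d)`-injective and `(n, d)`-flat modules -/

/-- `Ext_T^i(U, M) = 0`. -/
abbrev ExtVanishes (T : Type u) [Ring T] (U M : Type u) [AddCommGroup U] [Module T U]
    [AddCommGroup M] [Module T M] (i : ℕ) : Prop :=
  Subsingleton (Abelian.Ext (ModuleCat.of T U) (ModuleCat.of T M) i)

/-- The left `S`-module `M` is `(n, d)`-injective. -/
def IsNDInjective (S : Type u) [Ring S] (n d : ℕ) (M : Type u) [AddCommGroup M] [Module S M] :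
    Prop :=
  ∀ (U : Type u) [AddCommGroup U] [Module S U],
    IsFinitelyNPresented S n U → ExtVanishes S U M (d + 1)

/-- The left `R`-module `N` is `(n, d)`-flat (a notion considered for `1 ≤ n`). -/
def IsNDFlat (R : Type u) [Ring R] (n d : ℕ) (N : Type u) [AddCommGroup N] [Module R N] : Prop :=
  ∀ (U : Type u) [AddCommGroup U] [Module Rᵐᵒᵖ U],
    IsFinitelyNPresented Rᵐᵒᵖ n U → Subsingleton (Tor R U N (d + 1))

/-! ### Special semidualizing bimodules and the relative classes -/

section Bimodule

variable (S R : Type u) [Ring S] [Ring R]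

/-- The `(S, R)`-bimodule `C` is semidualizing. -/
structure IsSemidualizing (C : Type u) [AddCommGroup C] [Module S C] [Module Rᵐᵒᵖ C]
    [SMulCommClass S Rᵐᵒᵖ C] : Prop where
  left_resolution : HasFiniteProjectiveResolution S C
  right_resolution : HasFiniteProjectiveResolution Rᵐᵒᵖ C
  /-- `S → Hom_{Rᵒᵖ}(C, C)`, `s ↦ (x ↦ s x)`, is bijective. -/
  left_homothety : Function.Bijective fun s : S =>
    ({ toFun := fun x => s • x
       map_add' := smul_add s
       map_smul' := fun r x => smul_comm s r x } : C →ₗ[Rᵐᵒᵖ] C)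
  /-- `R → Hom_S(C, C)`, `r ↦ (x ↦ x r)`, is bijective. -/
  right_homothety : Function.Bijective fun r : R =>
    ({ toFun := fun x => MulOpposite.op r • x
       map_add' := smul_add (MulOpposite.op r)
       map_smul' := fun s x => (smul_comm s (MulOpposite.op r) x).symm } : C →ₗ[S] C)
  left_ext : ∀ i, 1 ≤ i → ExtVanishes S C C i
  right_ext : ∀ i, 1 ≤ i → ExtVanishes Rᵐᵒᵖ C C i

/-- The `(S, R)`-bimodule `K` is a special semidualizing bimodule with respect to the super finitely
presented `(S, R)`-bimodule `C`, that is, `K = K_{d-1}` is semidualizing and is a `(d-1)`-th syzygy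
of `C`, both on the left and on the right. The two one-sided resolutions need not come from one
resolution by bimodules. -/
structure IsSpecialSemidualizing (d : ℕ) (C K : Type u)
    [AddCommGroup C] [Module S C] [Module Rᵐᵒᵖ C] [SMulCommClass S Rᵐᵒᵖ C]
    [AddCommGroup K] [Module S K] [Module Rᵐᵒᵖ K] [SMulCommClass S Rᵐᵒᵖ K] : Prop where
  semidualizing : IsSemidualizing S R K
  left_syzygy : IsPredSyzygy S C K d
  right_syzygy : IsPredSyzygy Rᵐᵒᵖ C K d

variable (K : Type u) [AddCommGroup K] [Module S K] [Module Rᵐᵒᵖ K] [SMulCommClass S Rᵐᵒᵖ K]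

/-- The left `R`-module `M` is `K`-`(n, d)`-injective: it is of the form `Hom_S(K, I)` for an
`(n, d)`-injective `S`-module `I`. -/
def IsRelNDInjective (n d : ℕ) (M : Type u) [AddCommGroup M] [Module R M] : Prop :=
  ∃ (I : Type u) (_ : AddCommGroup I) (_ : Module S I),
    IsNDInjective S n d I ∧ Nonempty (M ≃ₗ[R] BimodHom S K I)

/-- The left `S`-module `N` is `K`-`(n, d)`-flat: it is of the form `K ⊗_R F` for an
`(n, d)`-flat `R`-module `F`. -/
def IsRelNDFlat (n d : ℕ) (N : Type u) [AddCommGroup N] [Module S N] : Prop :=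
  ∃ (F : Type u) (_ : AddCommGroup F) (_ : Module R F),
    IsNDFlat R n d F ∧ Nonempty (N ≃ₗ[S] BalTensor S R K F)

end Bimodule

end SpecialSemidualizing

end

/-! From (1) to (2) and (3): `Hom_S(K, -)` commutes with products, and with direct sums since `K` is
finitely generated; `K ⊗_R -` commutes with direct sums, and with products since `K` is finitely
presented on the right. The `(n, d)`-injective and `(n, d)`-flat classes are themselves closed under
both operations.

For the converses each `M_j` is a retract of the product and of the direct sum, so both relative
classes must be closed under retracts. This holds because idempotents of `Hom_S(K, I)` and of `K ⊗_R
F` come from idempotents of `I` and of `F`, and these split inside the two absolute classes.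

Idempotents descend by a duality argument (`exists_presentation`). Take a finite free resolution of
`K` over `B = Rᵐᵒᵖ`, put `A = S`, and apply `Hom_B(-, K)`. As `Ext_B(K, K) = 0` and `Hom_B(K, K) =
A`, the result is a coresolution `0 → A → K^{p_0} → K^{p_1} → ⋯` whose cosyzygies are of type FP_∞
over `A`. As `K` is a `(d-1)`-th syzygy of `C`, dimension shifting gives `Ext_A^i(K, I) = 0` for `i
≥ 1`. Shifting along the coresolution up to degree `d + 1` then kills `Ext_A^1` of the cosyzygies
into `I`, so `Hom_A(K, I)^{p_1} → Hom_A(K, I)^{p_0} → I → 0` is exact. This presentation is natural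
enough that a `B`-linear endomorphism of `Hom_A(K, I)` descends to `I`.

The flat case is reduced to the injective one by characters into `ℚ / ℤ`: `F` is `(n, d)`-flat iff
its character module is `(n, d)`-injective over `Rᵐᵒᵖ` (`isNDFlat_iff_dual`). The presentation for
that module, with `A = Rᵐᵒᵖ` and `B = S`, shows that `F → Hom_S(K, K ⊗_R F)` is bijective
(`existsUnique_btmul`). -/

namespace SpecialSemidualizing

/-! ### Vanishing of `Ext` along short exact sequences and retracts. -/

section ExtShift

open Abelian

variable {T : Type u} [Ring T] {A B C : Type u} [AddCommGroup A] [Module T A] [AddCommGroup B]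
  [Module T B] [AddCommGroup C] [Module T C] {f : A →ₗ[T] B} {g : B →ₗ[T] C}

theorem shortExact_ofHom (hf : Function.Injective f) (hfg : Function.Exact f g)
    (hg : Function.Surjective g) :
    (ModuleCat.shortComplexOfCompEqZero f g hfg.linearMap_comp_eq_zero).ShortExact :=
  ModuleCat.shortComplex_shortExact _ hfg hf hg

theorem extVanishes_of_projective (P M : Type u) [AddCommGroup P] [Module T P]
    [Module.Projective T P] [AddCommGroup M] [Module T M] {k : ℕ} (hk : 1 ≤ k) :
    ExtVanishes T P M k := by
  obtain ⟨k, rfl⟩ := Nat.exists_eq_add_of_le' hk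
  have := (ModuleCat.of T P).projective_of_categoryTheory_projective
  exact Ext.subsingleton_of_projective _ _ _

theorem extVanishes_of_injective (U I : Type u) [AddCommGroup U] [Module T U]
    [AddCommGroup I] [Module T I] [Module.Injective T I] {k : ℕ} (hk : 1 ≤ k) :
    ExtVanishes T U I k := by
  obtain ⟨k, rfl⟩ := Nat.exists_eq_add_of_le' hk
  have := Module.injective_object_of_injective_module T I
  exact Ext.subsingleton_of_injective _ _ _

theorem extVanishes_succ_of_left (M : Type u) [AddCommGroup M] [Module T M]
    (hf : Function.Injective f) (hfg : Function.Exact f g) (hg : Function.Surjective g) {k : ℕ}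
    (hA : ExtVanishes T A M k) (hB : ExtVanishes T B M (k + 1)) : ExtVanishes T C M (k + 1) := by
  refine subsingleton_of_forall_eq 0 fun x => ?_
  obtain ⟨y, rfl⟩ := Ext.contravariant_sequence_exact₃ (shortExact_ofHom hf hfg hg) _ x
    (hB.elim _ _) (add_comm 1 k)
  rw [hA.elim y 0, Ext.comp_zero]

theorem extVanishes_left_of_succ (M : Type u) [AddCommGroup M] [Module T M]
    (hf : Function.Injective f) (hfg : Function.Exact f g) (hg : Function.Surjective g) {k : ℕ}
    (hB : ExtVanishes T B M k) (hC : ExtVanishes T C M (k + 1)) : ExtVanishes T A M k := by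
  refine subsingleton_of_forall_eq 0 fun x => ?_
  obtain ⟨y, rfl⟩ := Ext.contravariant_sequence_exact₁ (shortExact_ofHom hf hfg hg) _ x
    (add_comm 1 k) (hC.elim _ _)
  rw [hB.elim y 0, Ext.comp_zero]

theorem extVanishes_right_of_succ (U : Type u) [AddCommGroup U] [Module T U]
    (hf : Function.Injective f) (hfg : Function.Exact f g) (hg : Function.Surjective g) {k : ℕ}
    (hB : ExtVanishes T U B k) (hA : ExtVanishes T U A (k + 1)) : ExtVanishes T U C k := by
  refine subsingleton_of_forall_eq 0 fun x => ?_
  obtain ⟨y, rfl⟩ := Ext.covariant_sequence_exact₃ _ (shortExact_ofHom hf hfg hg) x rfl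
    (hA.elim _ _)
  rw [hB.elim y 0, Ext.zero_comp]

theorem extVanishes_succ_of_right (U : Type u) [AddCommGroup U] [Module T U]
    (hf : Function.Injective f) (hfg : Function.Exact f g) (hg : Function.Surjective g) {k : ℕ}
    (hC : ExtVanishes T U C k) (hB : ExtVanishes T U B (k + 1)) : ExtVanishes T U A (k + 1) := by
  refine subsingleton_of_forall_eq 0 fun x => ?_
  obtain ⟨y, rfl⟩ := Ext.covariant_sequence_exact₁ _ (shortExact_ofHom hf hfg hg) x
    (hB.elim _ _) rfl
  rw [hC.elim y 0, Ext.zero_comp]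

theorem extVanishes_mid_left (M : Type u) [AddCommGroup M] [Module T M]
    (hf : Function.Injective f) (hfg : Function.Exact f g) (hg : Function.Surjective g) {k : ℕ}
    (hA : ExtVanishes T A M k) (hC : ExtVanishes T C M k) : ExtVanishes T B M k := by
  refine subsingleton_of_forall_eq 0 fun x => ?_
  obtain ⟨y, rfl⟩ := Ext.contravariant_sequence_exact₂ (shortExact_ofHom hf hfg hg) _ x
    (hA.elim _ _)
  rw [hC.elim y 0, Ext.comp_zero]

theorem exists_extension_of_extVanishes {M : Type u} [AddCommGroup M] [Module T M]
    (hf : Function.Injective f) (hfg : Function.Exact f g) (hg : Function.Surjective g)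
    (hC : ExtVanishes T C M 1) (φ : A →ₗ[T] M) : ∃ ψ : B →ₗ[T] M, ψ ∘ₗ f = φ := by
  obtain ⟨y, hy⟩ := Ext.contravariant_sequence_exact₁ (shortExact_ofHom hf hfg hg) _
    (Ext.mk₀ (ModuleCat.ofHom φ)) (add_comm 1 0) (hC.elim _ _)
  obtain ⟨ψ, rfl⟩ := (Ext.mk₀_bijective _ _).2 y
  rw [Ext.mk₀_comp_mk₀] at hy
  have := (Ext.mk₀_bijective _ _).1 hy
  exact ⟨ψ.hom, congrArg ModuleCat.Hom.hom this⟩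

/-- Every class comes from some `φ : A → M` by the connecting map. If `φ` factors through `f` the
class dies, because the class of the extension composed with `f` is zero. -/
theorem extVanishes_one_of_left {M : Type u} [AddCommGroup M] [Module T M]
    (hf : Function.Injective f) (hfg : Function.Exact f g) (hg : Function.Surjective g)
    (hB : ExtVanishes T B M 1) (h : ∀ φ : A →ₗ[T] M, ∃ ψ : B →ₗ[T] M, ψ ∘ₗ f = φ) :
    ExtVanishes T C M 1 := by
  refine subsingleton_of_forall_eq 0 fun x => ?_
  obtain ⟨y, rfl⟩ := Ext.contravariant_sequence_exact₃ (shortExact_ofHom hf hfg hg) _ x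
    (hB.elim _ _) (add_comm 1 0)
  obtain ⟨φ, rfl⟩ := (Ext.mk₀_bijective _ _).2 y
  obtain ⟨ψ, hψ⟩ := h φ.hom
  have : φ = ModuleCat.ofHom f ≫ ModuleCat.ofHom ψ := by
    ext : 1
    exact hψ.symm
  rw [this, ← Ext.mk₀_comp_mk₀]
  exact (shortExact_ofHom hf hfg hg).extClass_comp_assoc _

theorem exists_lift_of_extVanishes {U : Type u} [AddCommGroup U] [Module T U]
    (hf : Function.Injective f) (hfg : Function.Exact f g) (hg : Function.Surjective g)
    (hA : ExtVanishes T U A 1) (φ : U →ₗ[T] C) : ∃ ψ : U →ₗ[T] B, g ∘ₗ ψ = φ := by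
  obtain ⟨y, hy⟩ := Ext.covariant_sequence_exact₃ _ (shortExact_ofHom hf hfg hg)
    (Ext.mk₀ (ModuleCat.ofHom φ)) rfl (hA.elim _ _)
  obtain ⟨ψ, rfl⟩ := (Ext.mk₀_bijective _ _).2 y
  rw [Ext.mk₀_comp_mk₀] at hy
  have := (Ext.mk₀_bijective _ _).1 hy
  exact ⟨ψ.hom, congrArg ModuleCat.Hom.hom this⟩

theorem extVanishes_one_of_right {U : Type u} [AddCommGroup U] [Module T U]
    (hf : Function.Injective f) (hfg : Function.Exact f g) (hg : Function.Surjective g)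
    (hB : ExtVanishes T U B 1) (h : ∀ φ : U →ₗ[T] C, ∃ ψ : U →ₗ[T] B, g ∘ₗ ψ = φ) :
    ExtVanishes T U A 1 := by
  refine subsingleton_of_forall_eq 0 fun x => ?_
  obtain ⟨y, rfl⟩ := Ext.covariant_sequence_exact₁ _ (shortExact_ofHom hf hfg hg) x
    (hB.elim _ _) rfl
  obtain ⟨φ, rfl⟩ := (Ext.mk₀_bijective _ _).2 y
  obtain ⟨ψ, hψ⟩ := h φ.hom
  have : φ = ModuleCat.ofHom ψ ≫ ModuleCat.ofHom g := by
    ext : 1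
    exact hψ.symm
  rw [this, ← Ext.mk₀_comp_mk₀, Ext.comp_assoc_of_second_deg_zero]
  erw [(shortExact_ofHom hf hfg hg).comp_extClass]
  rw [Ext.comp_zero]

theorem extVanishes_of_retract_left (M : Type u) [AddCommGroup M] [Module T M] (i : A →ₗ[T] B)
    (p : B →ₗ[T] A) (h : p ∘ₗ i = LinearMap.id) {k : ℕ} (hB : ExtVanishes T B M k) :
    ExtVanishes T A M k := by
  refine subsingleton_of_forall_eq 0 fun x => ?_
  have hid : ModuleCat.ofHom i ≫ ModuleCat.ofHom p = 𝟙 (ModuleCat.of T A) := by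
    ext : 1
    exact h
  rw [← Ext.mk₀_id_comp x, ← hid, ← Ext.mk₀_comp_mk₀_assoc,
    hB.elim ((Ext.mk₀ (ModuleCat.ofHom p)).comp x (zero_add _)) 0, Ext.comp_zero]

theorem extVanishes_congr_left (M : Type u) [AddCommGroup M] [Module T M] (e : A ≃ₗ[T] B) {k : ℕ}
    (hB : ExtVanishes T B M k) : ExtVanishes T A M k :=
  extVanishes_of_retract_left M e.toLinearMap e.symm.toLinearMap
    (LinearMap.ext fun x => e.symm_apply_apply x) hB

theorem extVanishes_of_retract_right (U : Type u) [AddCommGroup U] [Module T U] (i : A →ₗ[T] B)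
    (p : B →ₗ[T] A) (h : p ∘ₗ i = LinearMap.id) {k : ℕ} (hB : ExtVanishes T U B k) :
    ExtVanishes T U A k := by
  refine subsingleton_of_forall_eq 0 fun x => ?_
  have hid : ModuleCat.ofHom i ≫ ModuleCat.ofHom p = 𝟙 (ModuleCat.of T A) := by
    ext : 1
    exact h
  rw [← Ext.comp_mk₀_id x, ← hid, ← Ext.mk₀_comp_mk₀, ← Ext.comp_assoc_of_second_deg_zero,
    hB.elim (x.comp (Ext.mk₀ (ModuleCat.ofHom i)) (add_zero _)) 0, Ext.zero_comp]

theorem exact_subtype_ker (g : B →ₗ[T] C) : Function.Exact (LinearMap.ker g).subtype g :=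
  LinearMap.exact_subtype_ker_map g

/-- The dimension shift behind all later inductions on the degree; `1 ≤ k` is what makes `Ext^k(B,
M)` vanish. -/
theorem extVanishes_succ_iff_ker [Module.Projective T B] (M : Type u) [AddCommGroup M] [Module T M]
    (hg : Function.Surjective g) {k : ℕ} (hk : 1 ≤ k) :
    ExtVanishes T C M (k + 1) ↔ ExtVanishes T (LinearMap.ker g) M k :=
  ⟨extVanishes_left_of_succ M (Submodule.injective_subtype _) (exact_subtype_ker g) hg
      (extVanishes_of_projective B M hk),
    fun h => extVanishes_succ_of_left M (Submodule.injective_subtype _) (exact_subtype_ker g) hg h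
      (extVanishes_of_projective B M (by omega))⟩

/-- The base case of those inductions: an elementary extension property replaces `Ext^1`. -/
theorem extVanishes_one_iff_ker [Module.Projective T B] (M : Type u) [AddCommGroup M] [Module T M]
    (hg : Function.Surjective g) : ExtVanishes T C M 1 ↔
      ∀ φ : LinearMap.ker g →ₗ[T] M, ∃ ψ : B →ₗ[T] M, ψ ∘ₗ (LinearMap.ker g).subtype = φ :=
  ⟨exists_extension_of_extVanishes (Submodule.injective_subtype _) (exact_subtype_ker g) hg,
    extVanishes_one_of_left (Submodule.injective_subtype _) (exact_subtype_ker g) hg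
      (extVanishes_of_projective B M le_rfl)⟩

end ExtShift

/-! ### Finitely `n`-presented modules, recursively, and finite free resolutions. -/

section FP

variable (T : Type u) [Ring T]

/-- `U` is finitely generated, and if `m > 0` then it is the quotient of a finite free module by a
submodule with the same property for `m - 1`. -/
def IsFP : ℕ → ∀ (U : Type u) [AddCommGroup U] [Module T U], Prop
  | 0, U, _, _ => Module.Finite T U
  | m + 1, U, _, _ => ∃ (r : ℕ) (f : (Fin r → T) →ₗ[T] U),
      Function.Surjective f ∧ IsFP m (LinearMap.ker f)

variable {T} {U V : Type u} [AddCommGroup U] [Module T U] [AddCommGroup V] [Module T V]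

theorem IsFP.congr (e : U ≃ₗ[T] V) : ∀ {m : ℕ}, IsFP T m U → IsFP T m V
  | 0, h => by
    have : Module.Finite T U := h
    exact Module.Finite.equiv e
  | m + 1, ⟨r, f, hf, hm⟩ =>
    ⟨r, e.toLinearMap ∘ₗ f, e.surjective.comp hf, by rwa [LinearEquiv.ker_comp]⟩

theorem IsFP.finite : ∀ {m : ℕ}, IsFP T m U → Module.Finite T U
  | 0, h => h
  | _ + 1, ⟨_, f, hf, _⟩ => Module.Finite.of_surjective f hf

theorem IsFP.pred : ∀ {m : ℕ} {U : Type u} [AddCommGroup U] [Module T U],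
    IsFP T (m + 1) U → IsFP T m U
  | 0, _, _, _, h => h.finite
  | _ + 1, _, _, _, ⟨r, f, hf, hm⟩ => ⟨r, f, hf, hm.pred⟩

theorem IsFP.mono {m m' : ℕ} (hm : m ≤ m') (h : IsFP T m' U) : IsFP T m U := by
  induction hm with
  | refl => exact h
  | step _ ih => exact ih h.pred

theorem IsFP.of_subsingleton : ∀ (m : ℕ) (U : Type u) [AddCommGroup U] [Module T U]
    [Subsingleton U], IsFP T m U
  | 0, U, _, _, _ => (inferInstance : Module.Finite T U)
  | m + 1, _, _, _, _ => ⟨0, 0, fun _ => ⟨0, Subsingleton.elim _ _⟩, IsFP.of_subsingleton m _⟩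

theorem IsFP.succ_of_free {m : ℕ} {G : Type u} [AddCommGroup G] [Module T G] [Module.Free T G]
    [Module.Finite T G] (f : G →ₗ[T] U) (hf : Function.Surjective f)
    (h : IsFP T m (LinearMap.ker f)) : IsFP T (m + 1) U := by
  let b := (Module.Free.chooseBasis T G).reindex (Fintype.equivFin _)
  let e := b.equivFun.symm
  refine ⟨_, f ∘ₗ e.toLinearMap, hf.comp e.surjective, h.congr ?_⟩
  refine LinearEquiv.ofBijective
    ((e.symm.toLinearMap ∘ₗ (LinearMap.ker f).subtype).codRestrict _ fun x => ?_) ⟨?_, ?_⟩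
  · simp
  · intro x y hxy
    exact Subtype.ext (e.symm.injective (congrArg Subtype.val hxy))
  · intro y
    exact ⟨⟨e y, y.2⟩, Subtype.ext (e.symm_apply_apply y)⟩

theorem IsFP.of_free (m : ℕ) (G : Type u) [AddCommGroup G] [Module T G] [Module.Free T G]
    [Module.Finite T G] : IsFP T m G := by
  refine IsFP.pred (IsFP.succ_of_free (LinearMap.id : G →ₗ[T] G) Function.surjective_id ?_)
  rw [LinearMap.ker_id]
  exact IsFP.of_subsingleton _ _

/-- Horseshoe argument: the covers of `A` and `C` combine to a cover `h` of `B`, and the kernels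
again form a short exact sequence `ker p → ker h → ker q`, to which the induction applies. -/
theorem IsFP.extension : ∀ {m : ℕ} {A B C : Type u} [AddCommGroup A] [Module T A] [AddCommGroup B]
    [Module T B] [AddCommGroup C] [Module T C] {f : A →ₗ[T] B} {g : B →ₗ[T] C}
    (_ : Function.Injective f) (_ : Function.Exact f g) (_ : Function.Surjective g)
    (_ : IsFP T m A) (_ : IsFP T m C), IsFP T m B
  | 0, A, B, C, _, _, _, _, _, _, f, g, hf, hfg, hg, hA, hC => by
    have : Module.Finite T A := hA
    have : Module.Finite T C := hC
    have h1 : Module.Finite T (LinearMap.ker g) := by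
      rw [hfg.linearMap_ker_eq]
      infer_instance
    have h2 : Module.Finite T (B ⧸ LinearMap.ker g) :=
      Module.Finite.equiv (g.quotKerEquivOfSurjective hg).symm
    exact Module.Finite.of_submodule_quotient (LinearMap.ker g)
  | m + 1, A, B, C, _, _, _, _, _, _, f, g, hf, hfg, hg, ⟨a, p, hp, hA⟩, ⟨c, q, hq, hC⟩ => by
    obtain ⟨s, hs⟩ := Module.projective_lifting_property g q hg
    have hs' : ∀ y, g (s y) = q y := fun y => LinearMap.congr_fun hs y
    let h : (Fin a → T) × (Fin c → T) →ₗ[T] B := (f ∘ₗ p).coprod s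
    have hgh : ∀ x, g (h x) = q x.2 := fun x => by
      simp [h, hs', hfg.apply_apply_eq_zero]
    refine IsFP.succ_of_free h (fun b => ?_) ?_
    · obtain ⟨y, hy⟩ := hq (g b)
      obtain ⟨x, hx⟩ := (hfg (b - s y)).1 (by rw [map_sub, hs', hy, sub_self])
      obtain ⟨x, rfl⟩ := hp x
      exact ⟨(x, y), by simp [h, hx]⟩
    · refine IsFP.extension
        (f := ((LinearMap.inl T _ _ ∘ₗ (LinearMap.ker p).subtype).codRestrict (LinearMap.ker h)
          fun x => ?_))
        (g := ((LinearMap.snd T _ _ ∘ₗ (LinearMap.ker h).subtype).codRestrict (LinearMap.ker q)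
          fun x => ?_)) ?_ ?_ ?_ hA hC
      · have : p x = 0 := x.2
        simp [h, this]
      · have : h x = 0 := x.2
        simpa [this] using (hgh x).symm
      · intro x y hxy
        exact Subtype.ext (congrArg Prod.fst (congrArg Subtype.val hxy))
      · rintro ⟨⟨x, y⟩, hxy⟩
        constructor
        · intro hy
          have hy : y = 0 := congrArg Subtype.val hy
          subst hy
          have : f (p x) + s 0 = 0 := hxy
          rw [map_zero, add_zero] at this
          exact ⟨⟨x, hf (this.trans (map_zero f).symm)⟩, rfl⟩
        · rintro ⟨x', hx'⟩
          ext1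
          exact (congrArg Prod.snd (congrArg Subtype.val hx')).symm
      · rintro ⟨y, hy⟩
        have hy : q y = 0 := hy
        obtain ⟨x, hx⟩ := (hfg (s y)).1 (by rw [hs', hy])
        obtain ⟨x, rfl⟩ := hp x
        refine ⟨⟨(-x, y), ?_⟩, rfl⟩
        simp [h, hx]

/-- A free cover `p` of `B` also covers `C`, and `ker (g ∘ p)` is an extension of `ker g ≅ A` by
`ker p`. -/
theorem IsFP.cokernel {m : ℕ} {A B C : Type u} [AddCommGroup A] [Module T A] [AddCommGroup B]
    [Module T B] [AddCommGroup C] [Module T C] {f : A →ₗ[T] B} {g : B →ₗ[T] C}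
    (hf : Function.Injective f) (hfg : Function.Exact f g) (hg : Function.Surjective g)
    (hA : IsFP T m A) (hB : IsFP T (m + 1) B) : IsFP T (m + 1) C := by
  obtain ⟨r, p, hp, hm⟩ := hB
  have hA' : IsFP T m (LinearMap.ker g) := by
    rw [hfg.linearMap_ker_eq]
    exact hA.congr (LinearEquiv.ofInjective f hf)
  refine ⟨r, g ∘ₗ p, hg.comp hp, ?_⟩
  have hle : LinearMap.ker p ≤ LinearMap.ker (g ∘ₗ p) := LinearMap.ker_le_ker_comp p g
  refine IsFP.extension (f := Submodule.inclusion hle)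
    (g := (p ∘ₗ (LinearMap.ker (g ∘ₗ p)).subtype).codRestrict (LinearMap.ker g) fun x => x.2)
    (Submodule.inclusion_injective hle) ?_ ?_ hm hA'
  · rintro ⟨x, hx⟩
    constructor
    · intro h
      exact ⟨⟨x, congrArg Subtype.val h⟩, rfl⟩
    · rintro ⟨y, hy⟩
      have : (y : Fin r → T) = x := congrArg Subtype.val hy
      ext1
      exact this ▸ y.2
  · rintro ⟨y, hy⟩
    obtain ⟨x, rfl⟩ := hp y
    exact ⟨⟨x, hy⟩, rfl⟩

theorem exact_single_funLeft_succ (U : Type u) [AddCommGroup U] [Module T U] (p : ℕ) :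
    Function.Exact (LinearMap.single T (fun _ : Fin (p + 1) => U) 0)
      (LinearMap.funLeft T U (Fin.succ : Fin p → Fin (p + 1))) := by
  intro x
  constructor
  · intro h
    refine ⟨x 0, funext fun i => ?_⟩
    refine Fin.cases (by simp) (fun i => ?_) i
    simpa using (congrFun h i).symm
  · rintro ⟨y, rfl⟩
    ext i
    simp

theorem IsFP.pow {m : ℕ} (h : IsFP T m U) : ∀ p : ℕ, IsFP T m (Fin p → U)
  | 0 => IsFP.of_subsingleton _ _
  | p + 1 => IsFP.extension (Pi.single_injective (M := fun _ : Fin (p + 1) => U) 0)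
      (exact_single_funLeft_succ U p)
      (LinearMap.funLeft_surjective_of_injective T U _ (Fin.succ_injective p)) h (h.pow p)

theorem extVanishes_pow (M : Type u) [AddCommGroup M] [Module T M] {k : ℕ} (hk : 1 ≤ k)
    (h : ExtVanishes T U M k) : ∀ p : ℕ, ExtVanishes T (Fin p → U) M k
  | 0 => extVanishes_of_projective _ _ hk
  | p + 1 => extVanishes_mid_left M (Pi.single_injective (M := fun _ : Fin (p + 1) => U) 0)
      (exact_single_funLeft_succ U p)
      (LinearMap.funLeft_surjective_of_injective T U _ (Fin.succ_injective p)) h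
      (extVanishes_pow M hk h p)

theorem IsFinitelyNPresented.isFP : ∀ {n : ℕ} {U : Type u} [AddCommGroup U] [Module T U],
    IsFinitelyNPresented T n U → IsFP T n U
  | 0, U, _, _, ⟨_, aug, _, h, _⟩ => Module.Finite.of_surjective aug h
  | n + 1, U, _, _, ⟨rank, aug, diff, h, h0, hs⟩ => by
    have h0 := h0 n.succ_pos
    refine ⟨_, aug, h, IsFinitelyNPresented.isFP ⟨fun i => rank (i + 1),
      (diff 0).codRestrict _ fun x => h0.apply_apply_eq_zero x, fun i => diff (i + 1),
      ?_, fun hn x => ?_, fun i hi => hs (i + 1) (by omega)⟩⟩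
    · rintro ⟨y, hy⟩
      obtain ⟨x, rfl⟩ := (h0 y).1 hy
      exact ⟨x, rfl⟩
    · rw [← hs 0 (by omega) x]
      exact Subtype.ext_iff

theorem IsFP.isFinitelyNPresented : ∀ {n : ℕ} {U : Type u} [AddCommGroup U] [Module T U],
    IsFP T n U → IsFinitelyNPresented T n U
  | 0, U, _, _, h => by
    have : Module.Finite T U := h
    obtain ⟨r, f, hf⟩ := Module.Finite.exists_fin' T U
    -- For `n = 0` only the surjection is constrained; the other ranks and the zero maps are
    -- fillers.
    exact ⟨fun _ => r, f, fun _ => 0, hf, fun h => absurd h (lt_irrefl _),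
      fun i hi => absurd hi (Nat.not_lt_zero _)⟩
  | n + 1, U, _, _, ⟨r, f, hf, h⟩ => by
    obtain ⟨rank, aug, diff, h, h0, hs⟩ := h.isFinitelyNPresented
    refine ⟨fun i => Nat.casesOn i r rank, f, fun i => match i with
      | 0 => (LinearMap.ker f).subtype ∘ₗ aug
      | i + 1 => diff i, hf, fun _ x => ?_, fun i hi => ?_⟩
    · refine ⟨fun hx => ?_, ?_⟩
      · obtain ⟨y, hy⟩ := h ⟨x, hx⟩
        exact ⟨y, congrArg Subtype.val hy⟩
      · rintro ⟨y, rfl⟩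
        exact (aug y).2
    · match i with
      | 0 =>
        intro x
        rw [← h0 (by omega) x]
        exact ⟨fun h => Subtype.ext h, fun h => congrArg Subtype.val h⟩
      | i + 1 => exact hs i (by omega)

/-- Removing the term of degree zero from a resolution of `U` gives a resolution of the zeroth
syzygy of `U`. -/
def FiniteFreeResolution.shift (P : FiniteFreeResolution T U) :
    FiniteFreeResolution T (LinearMap.ker P.aug) where
  rank i := P.rank (i + 1)
  aug := (P.diff 0).codRestrict _ fun x => P.exact_zero.apply_apply_eq_zero x
  diff i := P.diff (i + 1)
  aug_surjective := by
    rintro ⟨y, hy⟩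
    obtain ⟨x, rfl⟩ := (P.exact_zero y).1 hy
    exact ⟨x, rfl⟩
  exact_zero x := by
    rw [← P.exact_succ 0 x]
    exact Subtype.ext_iff
  exact_succ i := P.exact_succ (i + 1)

theorem FiniteFreeResolution.isFP : ∀ (m : ℕ) {U : Type u} [AddCommGroup U] [Module T U],
    FiniteFreeResolution T U → IsFP T m U
  | 0, _, _, _, P => Module.Finite.of_surjective P.aug P.aug_surjective
  | m + 1, _, _, _, P => ⟨_, P.aug, P.aug_surjective, P.shift.isFP m⟩

/-- Transport of a resolution along an isomorphism. -/
def FiniteFreeResolution.congr (P : FiniteFreeResolution T U) (e : U ≃ₗ[T] V) :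
    FiniteFreeResolution T V where
  rank := P.rank
  aug := e.toLinearMap ∘ₗ P.aug
  diff := P.diff
  aug_surjective := e.surjective.comp P.aug_surjective
  exact_zero x := by
    rw [← P.exact_zero x]
    simp
  exact_succ := P.exact_succ

theorem FiniteFreeResolution.syzygy_shift (P : FiniteFreeResolution T U) :
    ∀ m, P.shift.syzygy m = P.syzygy (m + 1)
  | 0 => LinearMap.ker_codRestrict _ _ _
  | _ + 1 => rfl

theorem FiniteFreeResolution.nonempty_syzygy : ∀ (m : ℕ) {U : Type u} [AddCommGroup U] [Module T U]
    (P : FiniteFreeResolution T U), Nonempty (FiniteFreeResolution T (P.syzygy m))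
  | 0, _, _, _, P => ⟨P.shift⟩
  | m + 1, _, _, _, P => by
    rw [← P.syzygy_shift m]
    exact nonempty_syzygy m P.shift

theorem FiniteFreeResolution.extVanishes_syzygy (M : Type u) [AddCommGroup M] [Module T M] {k : ℕ}
    (hk : 1 ≤ k) : ∀ (m : ℕ) {U : Type u} [AddCommGroup U] [Module T U]
    (P : FiniteFreeResolution T U) (_ : ExtVanishes T U M (k + m + 1)),
    ExtVanishes T (P.syzygy m) M k
  | 0, _, _, _, P, h => (extVanishes_succ_iff_ker M P.aug_surjective hk).1 h
  | m + 1, _, _, _, P, h => by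
    have := extVanishes_syzygy M hk m P.shift
      ((extVanishes_succ_iff_ker M P.aug_surjective (by omega)).1 h)
    rwa [P.syzygy_shift m] at this

/-- The first syzygy of a super finitely presented module is again super finitely presented, so
vanishing in one degree for all such modules passes to the next degree. -/
theorem FiniteFreeResolution.extVanishes_of_le {d : ℕ} {M : Type u} [AddCommGroup M] [Module T M]
    (hM : ∀ (V : Type u) [AddCommGroup V] [Module T V], FiniteFreeResolution T V →
      ExtVanishes T V M (d + 1)) {k : ℕ} (hk : d + 1 ≤ k) :
    ∀ {U : Type u} [AddCommGroup U] [Module T U], FiniteFreeResolution T U →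
      ExtVanishes T U M k := by
  induction k, hk using Nat.le_induction with
  | base => exact fun P => hM _ P
  | succ k hk ih => exact fun P =>
      (extVanishes_succ_iff_ker M P.aug_surjective (by omega)).2 (ih P.shift)

end FP

/-! ### Products and direct sums of `(n, d)`-injective modules. -/

section Injective

variable {T : Type u} [Ring T]

theorem isNDInjective_iff {n d : ℕ} {M : Type u} [AddCommGroup M] [Module T M] :
    IsNDInjective T n d M ↔ ∀ (U : Type u) [AddCommGroup U] [Module T U], IsFP T n U →
      ExtVanishes T U M (d + 1) :=
  ⟨fun h U _ _ hU => h U hU.isFinitelyNPresented, fun h U _ _ hU => h U hU.isFP⟩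

theorem IsNDInjective.of_retract {n d : ℕ} {M N : Type u} [AddCommGroup M] [Module T M]
    [AddCommGroup N] [Module T N] (hN : IsNDInjective T n d N) (i : M →ₗ[T] N) (p : N →ₗ[T] M)
    (h : p ∘ₗ i = LinearMap.id) : IsNDInjective T n d M :=
  fun U _ _ hU => extVanishes_of_retract_right U i p h (hN U hU)

variable {J : Type u} (M : J → Type u) [∀ j, AddCommGroup (M j)] [∀ j, Module T (M j)]

/-- After dimension shifting to degree one, a map into the product is extended one component at a
time. -/
theorem extVanishes_pi {k : ℕ} : ∀ {U : Type u} [AddCommGroup U] [Module T U]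
    (_ : IsFP T k U) (_ : ∀ j, ExtVanishes T U (M j) (k + 1)), ExtVanishes T U (∀ j, M j) (k + 1) := by
  induction k with
  | zero =>
    intro U _ _ hU h
    have : Module.Finite T U := hU
    obtain ⟨r, f, hf⟩ := Module.Finite.exists_fin' T U
    rw [extVanishes_one_iff_ker _ hf]
    intro φ
    choose ψ hψ using fun j => (extVanishes_one_iff_ker (M j) hf).1 (h j) (LinearMap.proj j ∘ₗ φ)
    exact ⟨LinearMap.pi ψ, LinearMap.ext fun x => funext fun j => LinearMap.congr_fun (hψ j) x⟩
  | succ k ih =>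
    rintro U _ _ ⟨r, f, hf, hU⟩ h
    rw [extVanishes_succ_iff_ker _ hf (by omega)]
    exact ih hU fun j => (extVanishes_succ_iff_ker _ hf (by omega)).1 (h j)

open Classical in
/-- A linear map from a finitely generated module to a direct sum is determined by finitely many
components. -/
theorem exists_finset_component_eq_zero {W : Type u} [AddCommGroup W] [Module T W]
    [Module.Finite T W] (φ : W →ₗ[T] ⨁ j, M j) :
    ∃ s : Finset J, ∀ j ∉ s, DirectSum.component T J M j ∘ₗ φ = 0 := by
  obtain ⟨r, f, hf⟩ := Module.Finite.exists_fin' T W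
  refine ⟨Finset.univ.biUnion fun i : Fin r => DFinsupp.support (φ (f (Pi.single i 1))),
    fun j hj => ?_⟩
  have : (DirectSum.component T J M j ∘ₗ φ) ∘ₗ f = 0 := by
    refine LinearMap.pi_ext' fun i => LinearMap.ext_ring ?_
    have hj : j ∉ DFinsupp.support (φ (f (Pi.single i 1))) := fun h =>
      hj (Finset.mem_biUnion.2 ⟨i, Finset.mem_univ i, h⟩)
    exact DFinsupp.notMem_support_iff.1 hj
  refine LinearMap.ext fun w => ?_
  obtain ⟨x, rfl⟩ := hf w
  exact LinearMap.congr_fun this x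

open Classical in
-- In degree one the syzygy is finitely generated, so a map from it meets only finitely many
-- summands and finitely many extensions can be added up. Finite generation of that syzygy is why
-- the degree of presentation here is `k + 1`.
theorem extVanishes_directSum {k : ℕ} : ∀ {U : Type u} [AddCommGroup U] [Module T U]
    (_ : IsFP T (k + 1) U) (_ : ∀ j, ExtVanishes T U (M j) (k + 1)),
    ExtVanishes T U (⨁ j, M j) (k + 1) := by
  induction k with
  | zero =>
    rintro U _ _ ⟨r, f, hf, hU⟩ h
    have : Module.Finite T (LinearMap.ker f) := hU
    rw [extVanishes_one_iff_ker _ hf]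
    intro φ
    obtain ⟨s, hs⟩ := exists_finset_component_eq_zero M φ
    choose ψ hψ using fun j => (extVanishes_one_iff_ker (M j) hf).1 (h j)
      (DirectSum.component T J M j ∘ₗ φ)
    refine ⟨∑ j ∈ s, DirectSum.lof T J M j ∘ₗ ψ j, LinearMap.ext fun x => ?_⟩
    refine DFinsupp.ext fun j => ?_
    have hsum : (∑ j ∈ s, DirectSum.lof T J M j (ψ j x)) j = if j ∈ s then ψ j x else 0 := by
      rw [DFinsupp.finsetSum_apply]
      split_ifs with h
      · rw [Finset.sum_eq_single j]
        · exact DirectSum.of_eq_same j _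
        · intro i _ hij
          exact DirectSum.of_eq_of_ne _ _ _ (Ne.symm hij)
        · exact fun h' => absurd h h'
      · refine Finset.sum_eq_zero fun i hi => DirectSum.of_eq_of_ne _ _ _ ?_
        rintro rfl
        exact h hi
    simp only [LinearMap.comp_apply, LinearMap.sum_apply, Submodule.subtype_apply]
    refine hsum.trans ?_
    split_ifs with h
    · exact LinearMap.congr_fun (hψ j) x
    · exact (LinearMap.congr_fun (hs j h) x).symm
  | succ k ih =>
    rintro U _ _ ⟨r, f, hf, hU⟩ h
    rw [extVanishes_succ_iff_ker _ hf (by omega)]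
    exact ih hU fun j => (extVanishes_succ_iff_ker _ hf (by omega)).1 (h j)

variable {M}

theorem IsNDInjective.pi {n d : ℕ} (hn : d ≤ n) (h : ∀ j, IsNDInjective T n d (M j)) :
    IsNDInjective T n d (∀ j, M j) :=
  isNDInjective_iff.2 fun U _ _ hU =>
    extVanishes_pi M (hU.mono hn) fun j => isNDInjective_iff.1 (h j) U hU

theorem IsNDInjective.directSum {n d : ℕ} (hn : d + 1 ≤ n) (h : ∀ j, IsNDInjective T n d (M j)) :
    IsNDInjective T n d (⨁ j, M j) :=
  isNDInjective_iff.2 fun U _ _ hU =>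
    extVanishes_directSum M (hU.mono hn) fun j => isNDInjective_iff.1 (h j) U hU

end Injective

/-! ### The functor `Hom_B(-, K)` on short exact sequences and on finite free modules. -/

section Coresolution

variable {A : Type*} {B K : Type u} [Ring A] [Ring B] [AddCommGroup K] [Module A K] [Module B K]
  [SMulCommClass B A K]

section Exactness

variable {X Y Z : Type u} [AddCommGroup X] [Module B X] [AddCommGroup Y] [Module B Y]
  [AddCommGroup Z] [Module B Z] {f : X →ₗ[B] Y} {g : Y →ₗ[B] Z}

theorem lcomp_injective (hg : Function.Surjective g) :
    Function.Injective (LinearMap.lcomp A K g) := fun φ ψ h => by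
  ext z
  obtain ⟨y, rfl⟩ := hg z
  exact LinearMap.congr_fun h y

theorem exact_lcomp (hfg : Function.Exact f g) (hg : Function.Surjective g) :
    Function.Exact (LinearMap.lcomp A K g) (LinearMap.lcomp A K f) := by
  intro φ
  constructor
  · intro h
    have hle : LinearMap.ker g ≤ LinearMap.ker φ := fun y hy => by
      obtain ⟨x, rfl⟩ := (hfg y).1 hy
      exact LinearMap.congr_fun h x
    refine ⟨(LinearMap.ker g).liftQ φ hle ∘ₗ (g.quotKerEquivOfSurjective hg).symm.toLinearMap,
      LinearMap.ext fun y => ?_⟩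
    have : (g.quotKerEquivOfSurjective hg).symm (g y) = (LinearMap.ker g).mkQ y := by
      rw [LinearEquiv.symm_apply_eq]
      rfl
    simp [this]
  · rintro ⟨ψ, rfl⟩
    ext x
    simp [hfg.apply_apply_eq_zero]

theorem lcomp_surjective (hf : Function.Injective f) (hfg : Function.Exact f g)
    (hg : Function.Surjective g) (hZ : ExtVanishes B Z K 1) :
    Function.Surjective (LinearMap.lcomp A K f) :=
  exists_extension_of_extVanishes hf hfg hg hZ

end Exactness

variable (A B K)

/-- `Hom_B(B ^ p, K)` is isomorphic to `K ^ p`. -/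
noncomputable def homFreeEquiv (p : ℕ) : (Fin p → K) ≃ₗ[A] ((Fin p → B) →ₗ[B] K) :=
  (Pi.basisFun B (Fin p)).constr A

variable {A B K}

@[simp]
theorem homFreeEquiv_single {p : ℕ} (x : Fin p → K) (i : Fin p) :
    homFreeEquiv A B K p x (Pi.single i 1) = x i := by
  rw [← Pi.basisFun_apply, homFreeEquiv, Module.Basis.constr_basis]

theorem homFreeEquiv_apply {p : ℕ} (x : Fin p → K) (b : Fin p → B) :
    homFreeEquiv A B K p x b = ∑ i, b i • x i := by
  rw [homFreeEquiv, Module.Basis.constr_apply_fintype]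
  simp

theorem homFreeEquiv_of_apply_single {p : ℕ} (φ : (Fin p → B) →ₗ[B] K) :
    homFreeEquiv A B K p (fun i => φ (Pi.single i 1)) = φ := by
  refine (Pi.basisFun B (Fin p)).ext fun i => ?_
  simp

end Coresolution

/-! ### The coresolution by powers of `K` and the resulting presentation of `I`. -/

section Presentation

variable {A B K : Type u} [Ring A] [Ring B] [AddCommGroup K] [Module A K] [Module B K]
  [SMulCommClass B A K]

/-- Since `Ext_B^1(Ω, K) = 0`, the module is the cokernel of `Hom_B(Ω, K) → K^p`, a map between
modules of type FP_∞. -/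
theorem isFP_hom_ker_aug {Ω : Type u} [AddCommGroup Ω] [Module B Ω] (P : FiniteFreeResolution B Ω)
    (hK : ∀ m, IsFP A m K) (h1 : ExtVanishes B Ω K 1) (h : ∀ m, IsFP A m (Ω →ₗ[B] K)) (m : ℕ) :
    IsFP A m (LinearMap.ker P.aug →ₗ[B] K) :=
  ((h m).cokernel (lcomp_injective P.aug_surjective)
    (exact_lcomp (exact_subtype_ker P.aug) P.aug_surjective)
    (lcomp_surjective (Submodule.injective_subtype _) (exact_subtype_ker P.aug) P.aug_surjective h1)
    (((hK (m + 1)).pow _).congr (homFreeEquiv A B K _))).pred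

/-- In `0 → Hom_B(Ω, K) → K^p → Hom_B(ker aug, K) → 0` the middle term has no `Ext_A` into `I`, so
degree `t` for `Ω` is controlled by degree `t + 1` for its syzygy. The number `e` counts the shifts
left until degree `d + 1`, where `hI` applies. -/
theorem extVanishes_hom {d : ℕ} {I : Type u} [AddCommGroup I] [Module A I]
    (hK : ∀ m, IsFP A m K) (hKI : ∀ i, 1 ≤ i → ExtVanishes A K I i)
    (hI : ∀ (V : Type u) [AddCommGroup V] [Module A V], (∀ m, IsFP A m V) →
      ExtVanishes A V I (d + 1)) (e : ℕ) : ∀ {t : ℕ} (_ : t + e = d + 1) (_ : 1 ≤ t)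
    {Ω : Type u} [AddCommGroup Ω] [Module B Ω] (_ : FiniteFreeResolution B Ω)
    (_ : ∀ i, 1 ≤ i → ExtVanishes B Ω K i) (_ : ∀ m, IsFP A m (Ω →ₗ[B] K)),
    ExtVanishes A (Ω →ₗ[B] K) I t := by
  induction e with
  | zero =>
    rintro t rfl - Ω _ _ P h1 h
    exact hI _ h
  | succ e ih =>
    rintro t ht ht1 Ω _ _ P h1 h
    refine extVanishes_left_of_succ I (lcomp_injective P.aug_surjective)
      (exact_lcomp (exact_subtype_ker P.aug) P.aug_surjective)
      (lcomp_surjective (Submodule.injective_subtype _) (exact_subtype_ker P.aug) P.aug_surjective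
        (h1 1 le_rfl)) ?_ ?_
    · exact extVanishes_congr_left I (homFreeEquiv A B K _).symm
        (extVanishes_pow I ht1 (hKI t ht1) _)
    · exact ih (by omega) (by omega) P.shift
        (fun i hi => (extVanishes_succ_iff_ker K P.aug_surjective hi).1 (h1 (i + 1) (by omega)))
        (isFP_hom_ker_aug P hK (h1 1 le_rfl) h)

/-- Let `K` be a bimodule over `A` and `B` with the properties of a semidualizing bimodule, and let
`I` be an `A`-module on which the required groups `Ext` vanish. Then the evaluations at generators
`k i` of `K` over `B` present `I` as a quotient of a power of `Hom_A(K, I)`, with relations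
coming from those of the `k i`. -/
theorem exists_presentation {d : ℕ} {I : Type u} [AddCommGroup I] [Module A I]
    (P : FiniteFreeResolution B K) (hK : ∀ m, IsFP A m K)
    (hKK : ∀ i, 1 ≤ i → ExtVanishes B K K i)
    (hA : Function.Bijective (LinearMap.toSpanSingleton A (K →ₗ[B] K) LinearMap.id))
    (hKI : ∀ i, 1 ≤ i → ExtVanishes A K I i)
    (hI : ∀ (V : Type u) [AddCommGroup V] [Module A V], (∀ m, IsFP A m V) →
      ExtVanishes A V I (d + 1)) :
    (∀ x : I, ∃ f : Fin (P.rank 0) → (K →ₗ[A] I),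
      ∑ i, f i (P.aug (Pi.single i 1)) = x) ∧
    ∀ f : Fin (P.rank 0) → (K →ₗ[A] I), ∑ i, f i (P.aug (Pi.single i 1)) = 0 →
      ∃ g : Fin (P.rank 1) → (K →ₗ[A] I),
        ∀ i y, f i y = ∑ j, g j (P.diff 0 (Pi.single j 1) i • y) := by
  have hKK1 : ∀ m, IsFP A m (K →ₗ[B] K) := fun m =>
    (IsFP.of_free m A).congr (LinearEquiv.ofBijective _ hA)
  have hi1 := lcomp_injective (A := A) (K := K) P.aug_surjective
  have he1 := exact_lcomp (A := A) (K := K) (exact_subtype_ker P.aug) P.aug_surjective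
  have hs1 := lcomp_surjective (A := A) (Submodule.injective_subtype _) (exact_subtype_ker P.aug)
    P.aug_surjective (hKK 1 le_rfl)
  have hKK' : ∀ i, 1 ≤ i → ExtVanishes B (LinearMap.ker P.aug) K i := fun i hi =>
    (extVanishes_succ_iff_ker K P.aug_surjective hi).1 (hKK (i + 1) (by omega))
  have hFP1 := isFP_hom_ker_aug P hK (hKK 1 le_rfl) hKK1
  -- The first cosyzygy starts in degree one and reaches degree `d + 1` after `d` shifts.
  have hE1 : ExtVanishes A (LinearMap.ker P.aug →ₗ[B] K) I 1 :=
    extVanishes_hom hK hKI hI d (by omega) le_rfl P.shift hKK' hFP1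
  have hi2 := lcomp_injective (A := A) (K := K) P.shift.aug_surjective
  have he2 := exact_lcomp (A := A) (K := K) (exact_subtype_ker P.shift.aug) P.shift.aug_surjective
  have hs2 := lcomp_surjective (A := A) (Submodule.injective_subtype _)
    (exact_subtype_ker P.shift.aug) P.shift.aug_surjective (hKK' 1 le_rfl)
  have hE2 : ExtVanishes A (LinearMap.ker P.shift.aug →ₗ[B] K) I 1 :=
    extVanishes_hom hK hKI hI d (by omega) le_rfl P.shift.shift
      (fun i hi => (extVanishes_succ_iff_ker K P.shift.aug_surjective hi).1
        (hKK' (i + 1) (by omega)))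
      (isFP_hom_ker_aug P.shift hK (hKK' 1 le_rfl) hFP1)
  constructor
  · intro x
    let e := LinearEquiv.ofBijective _ hA
    -- The map `a ↦ a x`, transported to `Hom_B(K, K) ≅ A`, extends to `K^{p_0}`. The identity goes
    -- to the tuple of generators in `K^{p_0}` and corresponds to `1`, so the components of the
    -- extension, evaluated at the generators, sum to `x`.
    obtain ⟨Φ, hΦ⟩ := exists_extension_of_extVanishes hi1 he1 hs1 hE1
      (LinearMap.toSpanSingleton A I x ∘ₗ e.symm.toLinearMap)
    refine ⟨fun i => Φ ∘ₗ (homFreeEquiv A B K _).toLinearMap ∘ₗ LinearMap.single A (fun _ => K) i, ?_⟩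
    have h1 : e.symm LinearMap.id = 1 := by
      rw [LinearEquiv.symm_apply_eq]
      exact (LinearMap.toSpanSingleton_apply_one A _ _).symm
    have h2 := LinearMap.congr_fun hΦ LinearMap.id
    simp only [LinearMap.comp_apply, LinearEquiv.coe_coe, h1, LinearMap.toSpanSingleton_apply,
      one_smul] at h2 ⊢
    rw [← h2, ← map_sum, ← map_sum]
    congr 1
    rw [LinearMap.lcomp_apply', LinearMap.id_comp, ← homFreeEquiv_of_apply_single (A := A) P.aug]
    congr 1
    ext i
    simp [Finset.sum_apply, Pi.single_apply]
  · intro f hf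
    let Φ : ((Fin (P.rank 0) → B) →ₗ[B] K) →ₗ[A] I :=
      ∑ i, f i ∘ₗ LinearMap.proj i ∘ₗ (homFreeEquiv A B K _).symm.toLinearMap
    have hΦ : ∀ x, Φ (homFreeEquiv A B K _ x) = ∑ i, f i (x i) := fun x => by
      simp [Φ, LinearMap.sum_apply]
    -- The image of `Hom_B(K, K) = A · id` in `K^{p_0}` is generated by the tuple of generators,
    -- which `Φ` kills by `hf`. Hence `Φ` factors as `θ` through the first cosyzygy.
    have hle : LinearMap.ker (LinearMap.lcomp A K (LinearMap.ker P.aug).subtype) ≤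
        LinearMap.ker Φ := by
      intro φ hφ
      obtain ⟨ψ, rfl⟩ := (he1 φ).1 hφ
      obtain ⟨a, rfl⟩ := hA.2 ψ
      rw [LinearMap.mem_ker, LinearMap.toSpanSingleton_apply, map_smul, map_smul,
        LinearMap.lcomp_apply', LinearMap.id_comp, ← homFreeEquiv_of_apply_single (A := A) P.aug,
        hΦ, hf, smul_zero]
    let θ := (LinearMap.ker _).liftQ Φ hle ∘ₗ
      (LinearMap.quotKerEquivOfSurjective _ hs1).symm.toLinearMap
    have hθ : ∀ φ, θ (LinearMap.lcomp A K (LinearMap.ker P.aug).subtype φ) = Φ φ := fun φ => by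
      have : (LinearMap.quotKerEquivOfSurjective _ hs1).symm
          (LinearMap.lcomp A K (LinearMap.ker P.aug).subtype φ) = (LinearMap.ker _).mkQ φ := by
        rw [LinearEquiv.symm_apply_eq]
        rfl
      simp only [θ, LinearMap.comp_apply, LinearEquiv.coe_coe, this]
      rfl
    -- The first cosyzygy embeds in `K^{p_1}` with the second as cokernel, so `θ` extends; the
    -- components of the extension are the required `g j`.
    obtain ⟨Θ, hΘ⟩ := exists_extension_of_extVanishes hi2 he2 hs2 hE2 θ
    let g : Fin (P.shift.rank 0) → (K →ₗ[A] I) := fun j =>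
      Θ ∘ₗ (homFreeEquiv A B K _).toLinearMap ∘ₗ LinearMap.single A (fun _ => K) j
    have hg : ∀ w : Fin (P.shift.rank 0) → K,
        ∑ j, g j (w j) = Θ (homFreeEquiv A B K _ w) := fun w => by
      simp only [g, LinearMap.comp_apply, LinearEquiv.coe_coe]
      rw [← map_sum, ← map_sum]
      congr 2
      ext j
      simp [Finset.sum_apply, Pi.single_apply]
    refine ⟨g, fun i y => ?_⟩
    have h1 : f i y = Φ (homFreeEquiv A B K _ (Pi.single i y)) := by
      rw [hΦ, Finset.sum_eq_single i]
      · simp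
      · intro l _ hl
        simp [Pi.single_eq_of_ne hl]
      · simp
    rw [h1, ← hθ, ← hΘ]
    refine Eq.trans (congrArg Θ ?_) (hg fun j => P.diff 0 (Pi.single j 1) i • y).symm
    rw [← homFreeEquiv_of_apply_single (A := A) (LinearMap.lcomp A K P.shift.aug _)]
    refine congrArg _ (funext fun j => ?_)
    have h2 : LinearMap.lcomp A K P.shift.aug (LinearMap.lcomp A K (LinearMap.ker P.aug).subtype
        (homFreeEquiv A B K _ (Pi.single i y))) (Pi.single j 1) =
        homFreeEquiv A B K _ (Pi.single i y) (P.diff 0 (Pi.single j 1)) := rfl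
    rw [h2, homFreeEquiv_apply, Finset.sum_eq_single i]
    · simp
    · intro l _ hl
      simp [Pi.single_eq_of_ne hl]
    · simp

end Presentation

/-! ### Vanishing of `Ext(K, I)` for a `(d-1)`-th syzygy `K`. -/

section Syzygy

variable {T : Type u} [Ring T] {U K : Type u} [AddCommGroup U] [Module T U] [AddCommGroup K]
  [Module T K] {d : ℕ}

theorem IsPredSyzygy.nonempty_resolution : ∀ {d : ℕ}, IsPredSyzygy T U K d →
    Nonempty (FiniteFreeResolution T K)
  | 0, ⟨⟨P⟩, ⟨e⟩⟩ => ⟨P.congr e.symm⟩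
  | m + 1, ⟨P, ⟨e⟩⟩ => by
    obtain ⟨Q⟩ := P.nonempty_syzygy m
    exact ⟨Q.congr e.symm⟩

/-- Dimension shifting reduces `Ext^i(K, I)` to `Ext^{i+d}(U, I)`, whose degree is at least `d + 1`.
-/
theorem IsPredSyzygy.extVanishes (h : IsPredSyzygy T U K d) (hd : 1 ≤ d) {n : ℕ} {I : Type u}
    [AddCommGroup I] [Module T I] (hI : IsNDInjective T n d I) {i : ℕ} (hi : 1 ≤ i) :
    ExtVanishes T K I i := by
  -- With `d = m + 1`, `K` is the syzygy of index `m`; index zero is already the kernel of the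
  -- augmentation, so the shift is by `m + 1 = d`.
  obtain ⟨m, rfl⟩ := Nat.exists_eq_add_of_le' hd
  obtain ⟨P, ⟨e⟩⟩ := h
  refine extVanishes_congr_left I e (P.extVanishes_syzygy I hi m ?_)
  exact FiniteFreeResolution.extVanishes_of_le
    (fun V _ _ Q => isNDInjective_iff.1 hI V (Q.isFP n)) (by omega) P

end Syzygy

/-! ### Descent of maps from `Hom_A(K, I)` to `I`. -/

section Descent

variable {A B K : Type u} [Ring A] [Ring B] [AddCommGroup K] [Module A K] [Module B K]
  [SMulCommClass B A K] {I I' : Type u} [AddCommGroup I] [Module A I] [AddCommGroup I'] [Module A I']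

theorem aug_eq_sum {K : Type u} [AddCommGroup K] [Module B K] {p : ℕ} (φ : (Fin p → B) →ₗ[B] K)
    (c : Fin p → B) : φ c = ∑ i, c i • φ (Pi.single i 1) := by
  conv_lhs => rw [← (Pi.basisFun B (Fin p)).sum_repr c]
  simp

/-- A `B`-linear map `Hom_A(K, I) → Hom_A(K, I')` is induced by an `A`-linear map `I → I'`. -/
theorem exists_linearMap_of_hom (P : FiniteFreeResolution B K)
    (hsurj : ∀ x : I, ∃ f : Fin (P.rank 0) → (K →ₗ[A] I),
      ∑ i, f i (P.aug (Pi.single i 1)) = x)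
    (hker : ∀ f : Fin (P.rank 0) → (K →ₗ[A] I), ∑ i, f i (P.aug (Pi.single i 1)) = 0 →
      ∃ g : Fin (P.rank 1) → (K →ₗ[A] I),
        ∀ i y, f i y = ∑ j, g j (P.diff 0 (Pi.single j 1) i • y))
    (e : (K →ₗ[A] I) →+ (K →ₗ[A] I'))
    (he : ∀ (b : B) (f : K →ₗ[A] I), e (f ∘ₗ DistribSMul.toLinearMap A K b) =
      e f ∘ₗ DistribSMul.toLinearMap A K b) :
    ∃ ε : I →ₗ[A] I', ∀ f x, ε (f x) = e f x := by
  let Ψ : (Fin (P.rank 0) → (K →ₗ[A] I)) →+ I :=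
    { toFun := fun f => ∑ i, f i (P.aug (Pi.single i 1))
      map_zero' := by simp
      map_add' := fun f g => by simp [Finset.sum_add_distrib] }
  let Ψ' : (Fin (P.rank 0) → (K →ₗ[A] I)) →+ I' :=
    { toFun := fun f => ∑ i, e (f i) (P.aug (Pi.single i 1))
      map_zero' := by simp
      map_add' := fun f g => by simp [Finset.sum_add_distrib] }
  -- By `hker` the kernel of evaluation at the generators comes from their relations, and `e`
  -- respects these because it commutes with `B`. So evaluation after `e` factors through `I`.
  have hle : Ψ.ker ≤ Ψ'.ker := by
    intro f hf
    obtain ⟨g, hg⟩ := hker f hf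
    have hef : ∀ i, e (f i) =
        ∑ j, e (g j) ∘ₗ DistribSMul.toLinearMap A K (P.diff 0 (Pi.single j 1) i) := fun i => by
      rw [← Finset.sum_congr rfl fun j _ => he _ (g j), ← map_sum]
      congr 1
      ext y
      simpa using hg i y
    change ∑ i, e (f i) (P.aug (Pi.single i 1)) = 0
    simp only [hef, LinearMap.sum_apply, LinearMap.comp_apply, DistribSMul.toLinearMap_apply]
    rw [Finset.sum_comm]
    refine Finset.sum_eq_zero fun j _ => ?_
    rw [← map_sum, ← aug_eq_sum, P.exact_zero.apply_apply_eq_zero, map_zero]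
  let ε : I →+ I' := Ψ.liftOfSurjective hsurj ⟨Ψ', hle⟩
  have hε : ∀ f, ε (Ψ f) = Ψ' f := Ψ.liftOfRightInverse_comp_apply _ _ ⟨Ψ', hle⟩
  have hεf : ∀ f x, ε (f x) = e f x := fun f x => by
    obtain ⟨c, rfl⟩ := P.aug_surjective x
    have h1 : f (P.aug c) = Ψ fun i => f ∘ₗ DistribSMul.toLinearMap A K (c i) := by
      simp [Ψ, aug_eq_sum P.aug c]
    have h2 : e f (P.aug c) = Ψ' fun i => f ∘ₗ DistribSMul.toLinearMap A K (c i) := by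
      simp [Ψ', aug_eq_sum P.aug c, he]
    rw [h1, h2, hε]
  refine ⟨{ ε with map_smul' := fun a x => ?_ }, hεf⟩
  obtain ⟨f, rfl⟩ := hsurj x
  change ε (a • _) = a • ε _
  rw [Finset.smul_sum, map_sum, map_sum, Finset.smul_sum]
  refine Finset.sum_congr rfl fun i _ => ?_
  rw [← map_smul, hεf, hεf, map_smul]

end Descent

/-! ### Retracts, products and direct sums of modules `Hom_S(K, I)`. -/

section RelInjective

variable {S R : Type u} [Ring S] [Ring R] {n d : ℕ} {C K : Type u}
  [AddCommGroup C] [Module S C] [Module Rᵐᵒᵖ C] [SMulCommClass S Rᵐᵒᵖ C]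
  [AddCommGroup K] [Module S K] [Module Rᵐᵒᵖ K] [SMulCommClass S Rᵐᵒᵖ K]

/-- The linear map underlying an element of `BimodHom S K I`. -/
def BimodHom.toHom {I : Type u} [AddCommGroup I] [Module S I] (f : BimodHom S K I) : K →ₗ[S] I := f

/-- A linear map as an element of `BimodHom S K I`. -/
def BimodHom.ofHom {I : Type u} [AddCommGroup I] [Module S I] (f : K →ₗ[S] I) : BimodHom S K I := f

/-- Composition with a linear map, as a map `Hom_S(K, I) → Hom_S(K, I')`. -/
def BimodHom.map (R : Type u) [Ring R] [Module Rᵐᵒᵖ K] [SMulCommClass S Rᵐᵒᵖ K] {I I' : Type u}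
    [AddCommGroup I] [Module S I] [AddCommGroup I'] [Module S I'] (φ : I →ₗ[S] I') :
    BimodHom S K I →ₗ[R] BimodHom S K I' where
  toFun f := .ofHom (φ ∘ₗ f.toHom)
  map_add' _ _ := LinearMap.comp_add _ _ _
  map_smul' _ _ := rfl

theorem IsSpecialSemidualizing.exists_presentation_left (hK : IsSpecialSemidualizing S R d C K)
    (hd : 1 ≤ d) {I : Type u} [AddCommGroup I] [Module S I] (hI : IsNDInjective S n d I) :
    ∃ P : FiniteFreeResolution Rᵐᵒᵖ K,
      (∀ x : I, ∃ f : Fin (P.rank 0) → (K →ₗ[S] I),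
        ∑ i, f i (P.aug (Pi.single i 1)) = x) ∧
      ∀ f : Fin (P.rank 0) → (K →ₗ[S] I), ∑ i, f i (P.aug (Pi.single i 1)) = 0 →
        ∃ g : Fin (P.rank 1) → (K →ₗ[S] I),
          ∀ i y, f i y = ∑ j, g j (P.diff 0 (Pi.single j 1) i • y) := by
  have : SMulCommClass Rᵐᵒᵖ S K := SMulCommClass.symm _ _ _
  obtain ⟨P⟩ := hK.right_syzygy.nonempty_resolution
  obtain ⟨Q⟩ := hK.left_syzygy.nonempty_resolution
  refine ⟨P, exists_presentation (d := d) P (fun m => Q.isFP m) hK.semidualizing.right_ext ?_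
    (fun i hi => hK.left_syzygy.extVanishes hd hI hi)
    fun V _ _ hV => isNDInjective_iff.1 hI V (hV n)⟩
  exact hK.semidualizing.left_homothety

/-- The idempotent of `Hom_S(K, I)` defined by the retract is composition with some `ε : I → I`.
Values of maps `K → I` generate `I`, so `ε` is idempotent. Its image is a retract of `I`, and maps
from `K` into that image are the elements of `M`. -/
theorem IsRelNDInjective.of_retract (hK : IsSpecialSemidualizing S R d C K)
    (hd : 1 ≤ d) {M N : Type u} [AddCommGroup M] [Module R M] [AddCommGroup N] [Module R N]
    (hN : IsRelNDInjective S R K n d N) (i : M →ₗ[R] N) (p : N →ₗ[R] M)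
    (hpi : p ∘ₗ i = LinearMap.id) : IsRelNDInjective S R K n d M := by
  have : SMulCommClass Rᵐᵒᵖ S K := SMulCommClass.symm _ _ _
  obtain ⟨I, _, _, hI, ⟨E⟩⟩ := hN
  obtain ⟨P, hsurj, hker⟩ := hK.exists_presentation_left hd hI
  let i' : M →ₗ[R] BimodHom S K I := E.toLinearMap ∘ₗ i
  let p' : BimodHom S K I →ₗ[R] M := p ∘ₗ E.symm.toLinearMap
  have hpi' : ∀ m, p' (i' m) = m := fun m => by
    simpa [i', p'] using LinearMap.congr_fun hpi m
  let e : (K →ₗ[S] I) →+ (K →ₗ[S] I) := (i' ∘ₗ p').toAddMonoidHom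
  obtain ⟨ε, hε⟩ := exists_linearMap_of_hom P hsurj hker e fun b f =>
    (i' ∘ₗ p').map_smul b.unop f
  have hεi : ∀ m x, ε ((i' m).toHom x) = (i' m).toHom x :=
    fun m x => (hε _ x).trans (congrArg (fun m => (i' m).toHom x) (hpi' m))
  have hεε : ∀ x, ε (ε x) = ε x := fun x => by
    obtain ⟨f, rfl⟩ := hsurj x
    simp only [map_sum, hε]
    refine Finset.sum_congr rfl fun j _ => ?_
    exact (hε _ _).symm.trans (hεi (p' (f j)) (P.aug (Pi.single j 1)))
  -- For an idempotent, the fixed points are the image.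
  let I' : Submodule S I := LinearMap.eqLocus ε LinearMap.id
  refine ⟨I', inferInstance, inferInstance,
    hI.of_retract I'.subtype (ε.codRestrict I' hεε) (LinearMap.ext fun x => Subtype.ext x.2), ⟨?_⟩⟩
  let F : M →ₗ[R] BimodHom S K I' :=
    { toFun := fun m => .ofHom ((i' m).toHom.codRestrict I' (hεi m))
      map_add' := fun m m' => LinearMap.ext fun x => Subtype.ext
        (LinearMap.congr_fun (i'.map_add m m') x)
      map_smul' := fun r m => LinearMap.ext fun x => Subtype.ext
        (LinearMap.congr_fun (i'.map_smul r m) x) }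
  refine LinearEquiv.ofBijective F ⟨fun m m' h => ?_, fun h => ?_⟩
  · have h1 : i' m = i' m' := LinearMap.ext fun x =>
      congrArg Subtype.val (LinearMap.congr_fun h x)
    rw [← hpi' m, h1, hpi']
  · refine ⟨p' (.ofHom (I'.subtype ∘ₗ h.toHom)), LinearMap.ext fun x => Subtype.ext ?_⟩
    exact (hε (I'.subtype ∘ₗ h.toHom) x).symm.trans (h.toHom x).2

variable {J : Type u}

/-- `Hom_S(K, -)` commutes with products. -/
def bimodHomPi (I : J → Type u) [∀ j, AddCommGroup (I j)] [∀ j, Module S (I j)] :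
    (∀ j, BimodHom S K (I j)) ≃ₗ[R] BimodHom S K (∀ j, I j) where
  toFun f := .ofHom (LinearMap.pi fun j => (f j).toHom)
  invFun g j := .ofHom (LinearMap.proj j ∘ₗ g.toHom)
  map_add' _ _ := rfl
  map_smul' _ _ := rfl
  left_inv _ := rfl
  right_inv _ := rfl

open Classical in
/-- `Hom_S(K, -)` commutes with direct sums for finitely generated `K`. -/
theorem nonempty_bimodHom_directSum [Module.Finite S K] (I : J → Type u)
    [∀ j, AddCommGroup (I j)] [∀ j, Module S (I j)] :
    Nonempty ((⨁ j, BimodHom S K (I j)) ≃ₗ[R] BimodHom S K (⨁ j, I j)) := by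
  let F : (⨁ j, BimodHom S K (I j)) →ₗ[R] BimodHom S K (⨁ j, I j) :=
    DirectSum.toModule R J _ fun j => BimodHom.map R (DirectSum.lof S J I j)
  -- Reading off components inverts `F` on its image; finite generation of `K` is needed only to see
  -- that every map is reached.
  have hF : ∀ j, BimodHom.map R (DirectSum.component S J I j) ∘ₗ F =
      DirectSum.component R J (fun j => BimodHom S K (I j)) j := by
    intro j
    refine DirectSum.linearMap_ext R fun l => LinearMap.ext fun g => ?_
    simp only [LinearMap.comp_apply, F, DirectSum.toModule_lof]
    refine LinearMap.ext fun x => ?_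
    change DirectSum.component S J I j (DirectSum.lof S J I l (g.toHom x)) = BimodHom.toHom _ x
    rw [DirectSum.component.of, DirectSum.component.of]
    split_ifs with h
    · subst h
      rfl
    · rfl
  have hF' : ∀ f x j, (F f).toHom x j = (f j).toHom x := fun f x j =>
    LinearMap.congr_fun (LinearMap.congr_fun (hF j) f) x
  refine ⟨LinearEquiv.ofBijective F ⟨fun f g h => ?_, fun h => ?_⟩⟩
  · refine DFinsupp.ext fun j => LinearMap.ext fun x => ?_
    refine (hF' f x j).symm.trans (Eq.trans ?_ (hF' g x j))
    rw [h]
  · obtain ⟨s, hs⟩ := exists_finset_component_eq_zero I h.toHom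
    let f : ⨁ j, BimodHom S K (I j) :=
      DFinsupp.mk s fun j => .ofHom (DirectSum.component S J I j ∘ₗ h.toHom)
    refine ⟨f, LinearMap.ext fun x => DFinsupp.ext fun j => (hF' f x j).trans ?_⟩
    by_cases hj : j ∈ s
    · have : f j = .ofHom (DirectSum.component S J I j ∘ₗ h.toHom) := DFinsupp.mk_of_mem hj
      rw [this]
      rfl
    · have : f j = 0 := DFinsupp.mk_of_notMem hj
      rw [this]
      exact (LinearMap.congr_fun (hs j hj) x).symm

variable {M : J → Type u} [∀ j, AddCommGroup (M j)] [∀ j, Module R (M j)]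

theorem IsRelNDInjective.pi (hn : d ≤ n) (h : ∀ j, IsRelNDInjective S R K n d (M j)) :
    IsRelNDInjective S R K n d (∀ j, M j) := by
  choose I i1 i2 hI E using h
  exact ⟨∀ j, I j, inferInstance, inferInstance, IsNDInjective.pi hn hI,
    ⟨(LinearEquiv.piCongrRight fun j => (E j).some).trans (bimodHomPi I)⟩⟩

open Classical in
theorem IsRelNDInjective.directSum [Module.Finite S K] (hn : d + 1 ≤ n)
    (h : ∀ j, IsRelNDInjective S R K n d (M j)) : IsRelNDInjective S R K n d (⨁ j, M j) := by
  choose I i1 i2 hI E using h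
  obtain ⟨F⟩ := nonempty_bimodHom_directSum (S := S) (R := R) (K := K) I
  exact ⟨⨁ j, I j, inferInstance, inferInstance, IsNDInjective.directSum hn hI,
    ⟨(DFinsupp.mapRange.linearEquiv fun j => (E j).some).trans F⟩⟩

end RelInjective

/-! ### Factors as retracts, and the equivalences of part (a). -/

section Retract

variable {R J : Type u} [Ring R] (M : J → Type u) [∀ j, AddCommGroup (M j)] [∀ j, Module R (M j)]

open Classical in
theorem proj_comp_single_eq_id (j : J) :
    LinearMap.proj j ∘ₗ LinearMap.single R M j = LinearMap.id := by
  ext x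
  simp

open Classical in
theorem component_comp_lof_eq_id (j : J) :
    DirectSum.component R J M j ∘ₗ DirectSum.lof R J M j = LinearMap.id :=
  LinearMap.ext fun x => DirectSum.component.lof_self R j x

end Retract

section

variable {S R : Type u} [Ring S] [Ring R] {n d : ℕ} {C K : Type u}
  [AddCommGroup C] [Module S C] [Module Rᵐᵒᵖ C] [SMulCommClass S Rᵐᵒᵖ C]
  [AddCommGroup K] [Module S K] [Module Rᵐᵒᵖ K] [SMulCommClass S Rᵐᵒᵖ K]

theorem isRelNDInjective_tfae (hd : 1 ≤ d) (hn : d + 1 < n)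
    (hK : IsSpecialSemidualizing S R d C K) {J : Type u} (M : J → Type u)
    [∀ j, AddCommGroup (M j)] [∀ j, Module R (M j)] :
    [∀ j, IsRelNDInjective S R K n d (M j), IsRelNDInjective S R K n d (∀ j, M j),
      IsRelNDInjective S R K n d (⨁ j, M j)].TFAE := by
  classical
  have : Module.Finite S K := by
    obtain ⟨Q⟩ := hK.left_syzygy.nonempty_resolution
    exact Q.isFP 0
  tfae_have 1 → 2 := IsRelNDInjective.pi (by omega)
  tfae_have 1 → 3 := IsRelNDInjective.directSum (by omega)
  tfae_have 2 → 1 := fun h j => h.of_retract hK hd _ _ (proj_comp_single_eq_id M j)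
  tfae_have 3 → 1 := fun h j => h.of_retract hK hd _ _ (component_comp_lof_eq_id M j)
  tfae_finish

end

/-! ### Characters with values in `ℚ / ℤ`. -/

section Character

/-- The injective cogenerator `ℚ / ℤ` of the category of abelian groups. -/
abbrev QZ : Type := AddCircle (1 : ℚ)

theorem exists_addMonoidHom_extension {X Y : Type u} [AddCommGroup X] [AddCommGroup Y] (f : X →+ Y)
    (hf : Function.Injective f) (φ : X →+ QZ) : ∃ ψ : Y →+ QZ, ψ.comp f = φ :=
  (Module.Baer.of_divisible QZ).extension_property_addMonoidHom f hf φ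

/-- Characters separate the points outside a subgroup from the subgroup. -/
theorem exists_character_of_notMem {X : Type u} [AddCommGroup X] (H : AddSubgroup X) {x : X}
    (hx : x ∉ H) : ∃ φ : X →+ QZ, (∀ h ∈ H, φ h = 0) ∧ φ x ≠ 0 := by
  have h0 : (QuotientAddGroup.mk' H x) ≠ 0 := fun h =>
    hx ((QuotientAddGroup.eq_zero_iff x).1 h)
  obtain ⟨c, hc⟩ := CharacterModule.exists_character_apply_ne_zero_of_ne_zero h0
  refine ⟨AddMonoidHom.comp c (QuotientAddGroup.mk' H), fun h hh => ?_, hc⟩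
  have : QuotientAddGroup.mk' H h = 0 := (QuotientAddGroup.eq_zero_iff h).2 hh
  exact (congrArg c this).trans (map_zero c)

theorem eq_of_forall_character {X : Type u} [AddCommGroup X] {x y : X}
    (h : ∀ φ : X →+ QZ, φ x = φ y) : x = y :=
  sub_eq_zero.1 (CharacterModule.eq_zero_of_character_apply fun c =>
    (map_sub (show X →+ QZ from c) x y).trans (sub_eq_zero.2 (h c)))

/-- By exactness `θ` kills the kernel of `b`, hence descends to the range of `b`; it then extends to
`Z` because `ℚ / ℤ` is injective. -/
theorem exists_addMonoidHom_factor {X Y Z : Type u} [AddCommGroup X] [AddCommGroup Y]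
    [AddCommGroup Z] {a : X →+ Y} {b : Y →+ Z} (h : Function.Exact a b) {θ : Y →+ QZ}
    (hθ : θ.comp a = 0) : ∃ η : Z →+ QZ, η.comp b = θ := by
  have hle : b.rangeRestrict.ker ≤ θ.ker := fun y hy => by
    obtain ⟨x, rfl⟩ := (h y).1 (congrArg Subtype.val hy)
    exact DFunLike.congr_fun hθ x
  let θ' : b.range →+ QZ := b.rangeRestrict.liftOfSurjective b.rangeRestrict_surjective ⟨θ, hle⟩
  have hθ' : ∀ y, θ' (b.rangeRestrict y) = θ y :=
    b.rangeRestrict.liftOfRightInverse_comp_apply _ _ ⟨θ, hle⟩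
  obtain ⟨η, hη⟩ := exists_addMonoidHom_extension b.range.subtype Subtype.val_injective θ'
  refine ⟨η, AddMonoidHom.ext fun y => ?_⟩
  rw [← hθ', ← hη]
  rfl

theorem exact_iff_forall_character {X Y Z : Type u} [AddCommGroup X] [AddCommGroup Y]
    [AddCommGroup Z] {a : X →+ Y} {b : Y →+ Z} (hab : ∀ x, b (a x) = 0) :
    Function.Exact a b ↔ ∀ θ : Y →+ QZ, θ.comp a = 0 → ∃ η : Z →+ QZ, η.comp b = θ := by
  refine ⟨fun h θ => exists_addMonoidHom_factor h, fun h y => ⟨fun hy => ?_, ?_⟩⟩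
  · by_contra hn
    obtain ⟨θ, hθ, hθy⟩ := exists_character_of_notMem a.range hn
    obtain ⟨η, rfl⟩ := h θ (AddMonoidHom.ext fun x => hθ _ ⟨x, rfl⟩)
    exact hθy (by rw [AddMonoidHom.comp_apply, hy, map_zero])
  · rintro ⟨x, rfl⟩
    exact hab x

end Character

/-! ### Character modules. -/

section Dual

variable (R : Type u) [Ring R]

/-- The character module `Hom_ℤ(N, ℚ / ℤ)` of a left `R`-module, as a right `R`-module. -/
def Dual (N : Type u) [AddCommGroup N] [Module R N] : Type u := N →+ QZ

/-- The character module `Hom_ℤ(X, ℚ / ℤ)` of a right `R`-module, as a left `R`-module. -/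
def RightDual (X : Type u) [AddCommGroup X] [Module Rᵐᵒᵖ X] : Type u := X →+ QZ

section

variable {R} {N : Type u} [AddCommGroup N] [Module R N]

instance : AddCommGroup (Dual R N) := inferInstanceAs (AddCommGroup (N →+ QZ))

instance : FunLike (Dual R N) N QZ := inferInstanceAs (FunLike (N →+ QZ) N QZ)

instance : AddMonoidHomClass (Dual R N) N QZ :=
  inferInstanceAs (AddMonoidHomClass (N →+ QZ) N QZ)

@[ext]
theorem Dual.ext {φ ψ : Dual R N} (h : ∀ y, φ y = ψ y) : φ = ψ := DFunLike.ext _ _ h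

instance : Module Rᵐᵒᵖ (Dual R N) where
  smul r φ := AddMonoidHom.comp φ (DistribSMul.toAddMonoidHom N r.unop)
  one_smul φ := Dual.ext fun y => congrArg φ (one_smul R y)
  mul_smul r s φ := Dual.ext fun y => congrArg φ (mul_smul s.unop r.unop y)
  smul_zero _ := rfl
  smul_add _ _ _ := rfl
  add_smul r s φ := Dual.ext fun y => (congrArg φ (add_smul r.unop s.unop y)).trans (map_add φ _ _)
  zero_smul φ := Dual.ext fun y => (congrArg φ (zero_smul R y)).trans (map_zero φ)

@[simp] theorem Dual.smul_apply (r : Rᵐᵒᵖ) (φ : Dual R N) (y : N) : (r • φ) y = φ (r.unop • y) := rfl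

@[simp] theorem Dual.add_apply (φ ψ : Dual R N) (y : N) : (φ + ψ) y = φ y + ψ y := rfl

@[simp] theorem Dual.zero_apply (y : N) : (0 : Dual R N) y = 0 := rfl

variable {X : Type u} [AddCommGroup X] [Module Rᵐᵒᵖ X]

instance : AddCommGroup (RightDual R X) := inferInstanceAs (AddCommGroup (X →+ QZ))

instance : FunLike (RightDual R X) X QZ := inferInstanceAs (FunLike (X →+ QZ) X QZ)

instance : AddMonoidHomClass (RightDual R X) X QZ :=
  inferInstanceAs (AddMonoidHomClass (X →+ QZ) X QZ)

theorem RightDual.ext {φ ψ : RightDual R X} (h : ∀ y, φ y = ψ y) : φ = ψ := DFunLike.ext _ _ h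

instance : Module R (RightDual R X) where
  smul r φ := AddMonoidHom.comp φ (DistribSMul.toAddMonoidHom X (MulOpposite.op r))
  one_smul φ := RightDual.ext fun y => congrArg φ (one_smul Rᵐᵒᵖ y)
  mul_smul r s φ := RightDual.ext fun y =>
    congrArg φ (mul_smul (MulOpposite.op s) (MulOpposite.op r) y)
  smul_zero _ := rfl
  smul_add _ _ _ := rfl
  add_smul r s φ := RightDual.ext fun y =>
    (congrArg φ (add_smul (MulOpposite.op r) (MulOpposite.op s) y)).trans (map_add φ _ _)
  zero_smul φ := RightDual.ext fun y => (congrArg φ (zero_smul Rᵐᵒᵖ y)).trans (map_zero φ)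

end

variable {R} {L M N : Type u} [AddCommGroup L] [Module R L] [AddCommGroup M] [Module R M]
  [AddCommGroup N] [Module R N]

/-- The transpose of a linear map on character modules. -/
def Dual.map (f : M →ₗ[R] N) : Dual R N →ₗ[Rᵐᵒᵖ] Dual R M where
  toFun φ := AddMonoidHom.comp φ f.toAddMonoidHom
  map_add' _ _ := rfl
  map_smul' r φ := Dual.ext fun y => congrArg φ (f.map_smul r.unop y).symm

@[simp] theorem Dual.map_apply (f : M →ₗ[R] N) (φ : Dual R N) (y : M) :
    Dual.map f φ y = φ (f y) := rfl

theorem Dual.map_surjective {f : M →ₗ[R] N} (hf : Function.Injective f) :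
    Function.Surjective (Dual.map f) := fun φ =>
  exists_addMonoidHom_extension f.toAddMonoidHom hf φ

theorem Dual.map_injective {f : M →ₗ[R] N} (hf : Function.Surjective f) :
    Function.Injective (Dual.map f) := fun φ ψ h => Dual.ext fun y => by
  obtain ⟨x, rfl⟩ := hf y
  exact DFunLike.congr_fun h x

theorem Dual.map_exact {f : L →ₗ[R] M} {g : M →ₗ[R] N} (h : Function.Exact f g) :
    Function.Exact (Dual.map g) (Dual.map f) := by
  intro φ
  constructor
  · intro hφ
    exact exists_addMonoidHom_factor (a := f.toAddMonoidHom) (b := g.toAddMonoidHom) h hφ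
  · rintro ⟨ψ, rfl⟩
    ext x
    simp [h.apply_apply_eq_zero]

/-- Exchanging the two arguments identifies maps `X → Dual R P` with maps `P → RightDual R X`.
Extension along `X → Y` becomes lifting along the surjection `RightDual R Y → RightDual R X`. -/
theorem injective_dual_of_projective (P : Type u) [AddCommGroup P] [Module R P]
    [Module.Projective R P] : Module.Injective Rᵐᵒᵖ (Dual R P) where
  out X Y _ _ _ _ f hf g := by
    let res : RightDual R Y →ₗ[R] RightDual R X :=
      { toFun := fun φ => AddMonoidHom.comp φ f.toAddMonoidHom
        map_add' := fun _ _ => rfl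
        map_smul' := fun r φ => RightDual.ext fun x =>
          congrArg φ (f.map_smul (MulOpposite.op r) x).symm }
    have hres : Function.Surjective res := fun φ =>
      exists_addMonoidHom_extension f.toAddMonoidHom hf φ
    let g' : P →ₗ[R] RightDual R X :=
      { toFun := fun p => AddMonoidHom.mk' (fun x => g x p) fun x y => by simp
        map_add' := fun p q => RightDual.ext fun x => map_add (g x) p q
        map_smul' := fun r p => RightDual.ext fun x =>
          (DFunLike.congr_fun (g.map_smul (MulOpposite.op r) x) p).symm }
    obtain ⟨h, hh⟩ := Module.projective_lifting_property res g' hres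
    refine ⟨{ toFun := fun y => AddMonoidHom.mk' (fun p => h p y) fun p q => ?_
              map_add' := fun y z => Dual.ext fun p => map_add (h p) y z
              map_smul' := fun r y => Dual.ext fun p => ?_ }, fun x => Dual.ext fun p => ?_⟩
    · rw [map_add]
      rfl
    · exact (DFunLike.congr_fun (h.map_smul r.unop p) y).symm
    · exact DFunLike.congr_fun (LinearMap.congr_fun hh p) x

end Dual

/-! ### Universal property of the balanced tensor product; its characters as maps `K → Dual R F`. -/

section BalTensor

variable (T : Type*) (R : Type u) {K F : Type u} [Ring T] [Ring R] [AddCommGroup K] [Module T K]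
    [Module Rᵐᵒᵖ K] [AddCommGroup F] [Module R F]

/-- The element `x ⊗ y` of `K ⊗_R F`. -/
def btmul (x : K) (y : F) : BalTensor T R K F := Submodule.Quotient.mk (x ⊗ₜ[ℤ] y)

theorem btmul_add (x : K) (y z : F) : btmul T R x (y + z) = btmul T R x y + btmul T R x z :=
  congrArg Submodule.Quotient.mk (TensorProduct.tmul_add x y z)

theorem add_btmul (x w : K) (y : F) : btmul T R (x + w) y = btmul T R x y + btmul T R w y :=
  congrArg Submodule.Quotient.mk (TensorProduct.add_tmul x w y)

theorem smul_btmul (t : T) (x : K) (y : F) : btmul T R (t • x) y = t • btmul T R x y := rfl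

theorem op_smul_btmul (x : K) (r : R) (y : F) :
    btmul T R (MulOpposite.op r • x) y = btmul T R x (r • y) :=
  (Submodule.Quotient.eq _).2 (Submodule.subset_span ⟨x, r, y, rfl⟩)

/-- `x ⊗ y` as a biadditive map. -/
def btmulHom : K →+ F →+ BalTensor T R K F :=
  AddMonoidHom.mk' (fun x => AddMonoidHom.mk' (btmul T R x) (btmul_add T R x))
    fun x w => AddMonoidHom.ext fun y => add_btmul T R x w y

@[simp] theorem btmulHom_apply (x : K) (y : F) : btmulHom T R x y = btmul T R x y := rfl

theorem btmul_zero (x : K) : btmul T R x (0 : F) = 0 := map_zero (btmulHom T R x)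

variable {T R}

theorem BalTensor.induction_on {p : BalTensor T R K F → Prop} (z : BalTensor T R K F) (h0 : p 0)
    (h1 : ∀ x y, p (btmul T R x y)) (h2 : ∀ z w, p z → p w → p (z + w)) : p z := by
  induction z using Submodule.Quotient.induction_on with
  | H z =>
    induction z using TensorProduct.induction_on with
    | zero => exact h0
    | tmul x y => exact h1 x y
    | add z w hz hw => exact h2 _ _ hz hw

theorem BalTensor.addHom_ext {G : Type*} [AddCommGroup G] {f g : BalTensor T R K F →+ G}
    (h : ∀ x y, f (btmul T R x y) = g (btmul T R x y)) : f = g := by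
  ext z
  induction z using BalTensor.induction_on with
  | h0 => simp
  | h1 x y => exact h x y
  | h2 z w hz hw => rw [map_add, map_add, hz, hw]

/-- The right `R`-linear map `K → Hom_ℤ(F, ℚ / ℤ)` that corresponds to a character of
`K ⊗_R F`. -/
def curry (θ : BalTensor T R K F →+ QZ) : K →ₗ[Rᵐᵒᵖ] Dual R F where
  toFun x := θ.comp (btmulHom T R x)
  map_add' x w := Dual.ext fun y => (congrArg θ (add_btmul T R x w y)).trans (map_add θ _ _)
  map_smul' r x := Dual.ext fun y => congrArg θ (op_smul_btmul T R x r.unop y)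

@[simp] theorem curry_apply (θ : BalTensor T R K F →+ QZ) (x : K) (y : F) :
    curry θ x y = θ (btmul T R x y) := rfl

variable [SMulCommClass T Rᵐᵒᵖ K]

/-- The additive map on `K ⊗_R F` defined by a balanced biadditive map. -/
def balLift {G : Type*} [AddCommGroup G] (f : K →+ F →+ G)
    (hf : ∀ x (r : R) y, f (MulOpposite.op r • x) y = f x (r • y)) : BalTensor T R K F →+ G :=
  QuotientAddGroup.lift (balancedRel T R K F).toAddSubgroup
    (TensorProduct.liftAddHom f fun n x y => by simp) (by
      intro z hz
      set φ := TensorProduct.liftAddHom (R := ℤ) f fun n x y => by simp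
      -- The relations form a `T`-span while `φ` is only additive, so the induction must carry all
      -- multiples of `z`.
      have key : ∀ t : T, φ (t • z) = 0 := by
        refine Submodule.span_induction (p := fun z _ => ∀ t : T, φ (t • z) = 0) ?_ ?_ ?_ ?_ hz
        · rintro _ ⟨x, r, y, rfl⟩ t
          rw [smul_sub, TensorProduct.smul_tmul', TensorProduct.smul_tmul', map_sub, smul_comm t]
          exact sub_eq_zero.2 (hf (t • x) r y)
        · intro t
          rw [smul_zero, map_zero]
        · intro z w _ _ hz hw t
          rw [smul_add, map_add, hz, hw, add_zero]
        · intro s z _ hz t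
          rw [smul_smul]
          exact hz _
      simpa using key 1)

@[simp] theorem balLift_btmul {G : Type*} [AddCommGroup G] (f : K →+ F →+ G)
    (hf : ∀ x (r : R) y, f (MulOpposite.op r • x) y = f x (r • y)) (x : K) (y : F) :
    balLift (T := T) f hf (btmul T R x y) = f x y := rfl

/-- The linear map on `K ⊗_R F` defined by a balanced biadditive map that is linear in the first
variable. -/
def balLiftLinear {G : Type*} [AddCommGroup G] [Module T G] (f : K →+ F →+ G)
    (hf : ∀ x (r : R) y, f (MulOpposite.op r • x) y = f x (r • y))
    (hT : ∀ (t : T) x y, f (t • x) y = t • f x y) : BalTensor T R K F →ₗ[T] G :=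
  { balLift f hf with
    map_smul' := fun t z => by
      change balLift f hf (t • z) = t • balLift f hf z
      induction z using BalTensor.induction_on with
      | h0 => rw [smul_zero, map_zero, smul_zero]
      | h1 x y => rw [← smul_btmul, balLift_btmul, balLift_btmul, hT]
      | h2 z w hz hw => rw [smul_add, map_add, map_add, hz, hw, smul_add] }

@[simp] theorem balLiftLinear_btmul {G : Type*} [AddCommGroup G] [Module T G] (f : K →+ F →+ G)
    (hf : ∀ x (r : R) y, f (MulOpposite.op r • x) y = f x (r • y))
    (hT : ∀ (t : T) x y, f (t • x) y = t • f x y) (x : K) (y : F) :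
    balLiftLinear f hf hT (btmul T R x y) = f x y := rfl

/-- The character of `K ⊗_R F` that corresponds to a right `R`-linear map
`K → Hom_ℤ(F, ℚ / ℤ)`. -/
def uncurry (f : K →ₗ[Rᵐᵒᵖ] Dual R F) : BalTensor T R K F →+ QZ :=
  balLift (AddMonoidHom.mk' (fun x => (f x : F →+ QZ)) fun x w => f.map_add x w)
    fun x r y => DFunLike.congr_fun (f.map_smul (MulOpposite.op r) x) y

@[simp] theorem uncurry_btmul (f : K →ₗ[Rᵐᵒᵖ] Dual R F) (x : K) (y : F) :
    uncurry (T := T) f (btmul T R x y) = f x y := rfl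

theorem curry_uncurry (f : K →ₗ[Rᵐᵒᵖ] Dual R F) : curry (uncurry (T := T) f) = f := rfl

end BalTensor

/-! ### Duality between `Tor` and `Ext`. -/

section Tor

variable {R : Type u} [Ring R] (U : Type u) [AddCommGroup U] [Module Rᵐᵒᵖ U]

theorem curry_comp_balTensorMap {F G : Type u} [AddCommGroup F] [Module R F] [AddCommGroup G]
    [Module R G] (f : F →ₗ[R] G) (θ : BalTensor ℤ R U G →+ QZ) :
    curry (θ.comp (balTensorMap R U f).toAddMonoidHom) = Dual.map f ∘ₗ curry θ := rfl

theorem balTensorMap_exact_iff {X Y Z : Type u} [AddCommGroup X] [Module R X] [AddCommGroup Y]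
    [Module R Y] [AddCommGroup Z] [Module R Z] {a : X →ₗ[R] Y} {b : Y →ₗ[R] Z}
    (hab : ∀ x, b (a x) = 0) :
    Function.Exact (balTensorMap R U a) (balTensorMap R U b) ↔
      ∀ θ : U →ₗ[Rᵐᵒᵖ] Dual R Y, Dual.map a ∘ₗ θ = 0 →
        ∃ η : U →ₗ[Rᵐᵒᵖ] Dual R Z, Dual.map b ∘ₗ η = θ := by
  have h0 : ∀ z, (balTensorMap R U b).toAddMonoidHom ((balTensorMap R U a).toAddMonoidHom z) = 0 :=
    fun z => by
    induction z using BalTensor.induction_on with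
    | h0 => simp
    | h1 x y =>
      change btmul ℤ R x (b (a y)) = 0
      rw [hab, btmul_zero]
    | h2 z w hz hw => rw [map_add, map_add, hz, hw, add_zero]
  refine (exact_iff_forall_character h0).trans ⟨fun h θ hθ => ?_, fun h θ hθ => ?_⟩
  · obtain ⟨η, hη⟩ := h (uncurry θ) (BalTensor.addHom_ext fun x y =>
      DFunLike.congr_fun (LinearMap.congr_fun hθ x) y)
    refine ⟨curry η, ?_⟩
    rw [← curry_comp_balTensorMap, hη, curry_uncurry]
  · obtain ⟨η, hη⟩ := h (curry θ) (by
      rw [← curry_comp_balTensorMap, hθ]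
      rfl)
    refine ⟨uncurry η, BalTensor.addHom_ext fun x y => ?_⟩
    exact DFunLike.congr_fun (LinearMap.congr_fun hη x) y

/-- If `P` is a projective resolution of `N`, then `Ext^{k+1}(U, Hom_ℤ(N, ℚ / ℤ))` is the
cohomology of `Hom(U, Hom_ℤ(P, ℚ / ℤ))`. -/
theorem extVanishes_dual_iff : ∀ (k : ℕ) {N : Type u} [AddCommGroup N] [Module R N]
    (P : ℕ → Type u) [∀ i, AddCommGroup (P i)] [∀ i, Module R (P i)]
    [∀ i, Module.Projective R (P i)] (aug : P 0 →ₗ[R] N) (D : ∀ i, P (i + 1) →ₗ[R] P i)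
    (_ : Function.Surjective aug) (_ : Function.Exact (D 0) aug)
    (_ : ∀ i, Function.Exact (D (i + 1)) (D i)),
    ExtVanishes Rᵐᵒᵖ U (Dual R N) (k + 1) ↔
      ∀ θ : U →ₗ[Rᵐᵒᵖ] Dual R (P (k + 1)), Dual.map (D (k + 1)) ∘ₗ θ = 0 →
        ∃ η : U →ₗ[Rᵐᵒᵖ] Dual R (P k), Dual.map (D k) ∘ₗ η = θ := by
  intro k
  induction k with
  | zero =>
    intro N _ _ P _ _ _ aug D haug h0 hs
    have := injective_dual_of_projective (R := R) (P 0)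
    let aug' : P 1 →ₗ[R] LinearMap.ker aug :=
      (D 0).codRestrict _ fun x => h0.apply_apply_eq_zero x
    have haug' : Function.Surjective aug' := by
      rintro ⟨y, hy⟩
      obtain ⟨x, rfl⟩ := (h0 y).1 hy
      exact ⟨x, rfl⟩
    have h0' : Function.Exact (D 1) aug' := fun x => by
      rw [← hs 0 x]
      exact Subtype.ext_iff
    have hi := Dual.map_injective haug
    have he := Dual.map_exact (exact_subtype_ker aug)
    have hsu := Dual.map_surjective (Submodule.injective_subtype (LinearMap.ker aug))
    have hD : Dual.map (D 0) = Dual.map aug' ∘ₗ Dual.map (LinearMap.ker aug).subtype := rfl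
    constructor
    · intro h θ hθ
      -- A cocycle `θ` takes values in the dual of the first syzygy. Lifting it to `Dual R (P 0)` is
      -- what `Ext^1` controls, because `Dual R (P 0)` is injective.
      have hθ' : ∀ u, θ u ∈ LinearMap.range (Dual.map aug') := fun u =>
        (Dual.map_exact h0' (θ u)).1 (LinearMap.congr_fun hθ u)
      let e := LinearEquiv.ofInjective _ (Dual.map_injective haug')
      obtain ⟨η, hη⟩ := exists_lift_of_extVanishes hi he hsu h
        (e.symm.toLinearMap ∘ₗ θ.codRestrict _ hθ')
      refine ⟨η, ?_⟩
      rw [hD, LinearMap.comp_assoc, hη]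
      exact LinearMap.ext fun u => congrArg Subtype.val (e.apply_symm_apply ⟨θ u, hθ' u⟩)
    · intro h
      refine extVanishes_one_of_right hi he hsu (extVanishes_of_injective _ _ le_rfl) fun φ => ?_
      obtain ⟨η, hη⟩ := h (Dual.map aug' ∘ₗ φ) (LinearMap.ext fun u =>
        (Dual.map_exact h0').apply_apply_eq_zero (φ u))
      refine ⟨η, LinearMap.ext fun u => Dual.map_injective haug' ?_⟩
      exact LinearMap.congr_fun hη u
  | succ k ih =>
    intro N _ _ P _ _ _ aug D haug h0 hs
    have := injective_dual_of_projective (R := R) (P 0)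
    have haug' : Function.Surjective ((D 0).codRestrict (LinearMap.ker aug)
        fun x => h0.apply_apply_eq_zero x) := by
      rintro ⟨y, hy⟩
      obtain ⟨x, rfl⟩ := (h0 y).1 hy
      exact ⟨x, rfl⟩
    rw [← ih (fun i => P (i + 1)) ((D 0).codRestrict (LinearMap.ker aug)
      fun x => h0.apply_apply_eq_zero x) (fun i => D (i + 1)) haug' (fun x => by
        rw [← hs 0 x]
        exact Subtype.ext_iff) fun i => hs (i + 1)]
    have hi := Dual.map_injective haug
    have he := Dual.map_exact (exact_subtype_ker aug)
    have hsu := Dual.map_surjective (Submodule.injective_subtype (LinearMap.ker aug))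
    exact ⟨extVanishes_right_of_succ U hi he hsu (extVanishes_of_injective _ _ (by omega)),
      fun h => extVanishes_succ_of_right U hi he hsu h (extVanishes_of_injective _ _ (by omega))⟩

/-- For a projective resolution `P` of `N`, `Tor` vanishes iff `U ⊗_R P` is exact in degree `k + 1`.
Characters turn this into exactness of `Hom(U, Dual P)`, which computes `Ext` because the duals of
projectives are injective. -/
theorem subsingleton_tor_iff (N : Type u) [AddCommGroup N] [Module R N] (k : ℕ) :
    Subsingleton (Tor R U N (k + 1)) ↔ ExtVanishes Rᵐᵒᵖ U (Dual R N) (k + 1) := by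
  let P := projectiveResolution (ModuleCat.of R N)
  have hproj : ∀ i, Module.Projective R (P.complex.X i) := fun i =>
    ModuleCat.projective_of_module_projective _
  have haug : Function.Surjective (P.π.f 0).hom :=
    (ModuleCat.epi_iff_surjective _).1 inferInstance
  have h0 : Function.Exact (P.complex.d 1 0).hom (P.π.f 0).hom :=
    (ShortComplex.ShortExact.moduleCat_exact_iff_function_exact _).1 P.exact₀
  have hs : ∀ i, Function.Exact (P.complex.d (i + 2) (i + 1)).hom (P.complex.d (i + 1) i).hom :=
    fun i => (ShortComplex.ShortExact.moduleCat_exact_iff_function_exact _).1 (P.exact_succ i)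
  refine Iff.trans ?_ (extVanishes_dual_iff U k (N := N) (fun i => P.complex.X i)
    (P.π.f 0).hom (fun i => (P.complex.d (i + 1) i).hom) haug h0 hs).symm
  rw [← balTensorMap_exact_iff U (hs k).apply_apply_eq_zero]
  have h1 : Subsingleton (Tor R U N (k + 1)) ↔
      Limits.IsZero (((tensorFunctor R U).leftDerived (k + 1)).obj (ModuleCat.of R N)) :=
    ModuleCat.isZero_iff_subsingleton.symm
  rw [h1, (P.isoLeftDerivedObj (tensorFunctor R U) (k + 1)).isZero_iff]
  refine (HomologicalComplex.exactAt_iff_isZero_homology _ _).symm.trans ?_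
  rw [HomologicalComplex.exactAt_iff' _ (k + 2) (k + 1) k (by simp) (by simp)]
  exact ShortComplex.ShortExact.moduleCat_exact_iff_function_exact _

theorem isNDFlat_iff_dual {n d : ℕ} (N : Type u) [AddCommGroup N] [Module R N] :
    IsNDFlat R n d N ↔ IsNDInjective Rᵐᵒᵖ n d (Dual R N) :=
  ⟨fun h U _ _ hU => (subsingleton_tor_iff U N d).1 (h U hU),
    fun h U _ _ hU => (subsingleton_tor_iff U N d).2 (h U hU)⟩

end Tor

/-! ### Functoriality of the tensor product in both variables. -/

section Functoriality

variable {T : Type*} {R K : Type u} [Ring T] [Ring R] [AddCommGroup K] [Module T K]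
  [Module Rᵐᵒᵖ K] [SMulCommClass T Rᵐᵒᵖ K] {F G : Type u} [AddCommGroup F] [Module R F]
  [AddCommGroup G] [Module R G]

variable (T K) in
/-- The map `K ⊗_R F → K ⊗_R G` induced by `F → G`. -/
def BalTensor.map (f : F →ₗ[R] G) : BalTensor T R K F →ₗ[T] BalTensor T R K G :=
  balLiftLinear
    (AddMonoidHom.mk' (fun x => (btmulHom T R x).comp f.toAddMonoidHom) fun x w =>
      AddMonoidHom.ext fun y => add_btmul T R x w (f y))
    (fun x r y => (op_smul_btmul T R x r (f y)).trans (congrArg _ (f.map_smul r y).symm))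
    fun _ _ _ => rfl

@[simp] theorem BalTensor.map_btmul (f : F →ₗ[R] G) (x : K) (y : F) :
    BalTensor.map T K f (btmul T R x y) = btmul T R x (f y) := rfl

/-- The map `K ⊗_R F → L ⊗_R F` induced by `K → L`. -/
def BalTensor.mapLeft {K L : Type u} [AddCommGroup K] [Module Rᵐᵒᵖ K] [AddCommGroup L]
    [Module Rᵐᵒᵖ L] (f : K →ₗ[Rᵐᵒᵖ] L) : BalTensor ℤ R K F →+ BalTensor ℤ R L F :=
  balLift ((btmulHom ℤ R).comp f.toAddMonoidHom) fun x r y =>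
    (congrArg (fun x => btmul ℤ R x y) (f.map_smul (MulOpposite.op r) x)).trans
      (op_smul_btmul ℤ R (f x) r y)

@[simp] theorem BalTensor.mapLeft_btmul {K L : Type u} [AddCommGroup K] [Module Rᵐᵒᵖ K]
    [AddCommGroup L] [Module Rᵐᵒᵖ L] (f : K →ₗ[Rᵐᵒᵖ] L) (x : K) (y : F) :
    BalTensor.mapLeft f (btmul ℤ R x y) = btmul ℤ R (f x) y := rfl

omit [SMulCommClass T Rᵐᵒᵖ K] in
theorem BalTensor.linearMap_ext {H : Type*} [AddCommGroup H] [Module T H]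
    {f g : BalTensor T R K F →ₗ[T] H}
    (h : ∀ x y, f (btmul T R x y) = g (btmul T R x y)) : f = g :=
  LinearMap.toAddMonoidHom_injective (BalTensor.addHom_ext h)

end Functoriality

/-! ### The tensor product on products and direct sums. -/

section Products

variable {T : Type*} {R K : Type u} [Ring T] [Ring R] [AddCommGroup K] [Module T K]
  [Module Rᵐᵒᵖ K]

theorem Dual.sum_apply {F : Type u} [AddCommGroup F] [Module R F] {ι : Type*} (s : Finset ι)
    (φ : ι → Dual R F) (y : F) : (∑ i ∈ s, φ i) y = ∑ i ∈ s, φ i y :=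
  map_sum (AddMonoidHom.mk' (fun φ : Dual R F => φ y) fun _ _ => rfl) φ s

theorem btmul_sum {F : Type u} [AddCommGroup F] [Module R F] {ι : Type*} (s : Finset ι) (x : K)
    (y : ι → F) : btmul T R x (∑ i ∈ s, y i) = ∑ i ∈ s, btmul T R x (y i) :=
  map_sum (btmulHom T R x) y s

theorem sum_btmul {F : Type u} [AddCommGroup F] [Module R F] {ι : Type*} (s : Finset ι) (x : ι → K)
    (y : F) : btmul T R (∑ i ∈ s, x i) y = ∑ i ∈ s, btmul T R (x i) y :=
  (DFunLike.congr_fun (map_sum (btmulHom T R (F := F)) x s) y).trans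
    (AddMonoidHom.finsetSum_apply _ _ _)

theorem exists_eq_sum_btmul {a : ℕ} (aug : (Fin a → Rᵐᵒᵖ) →ₗ[Rᵐᵒᵖ] K)
    (haug : Function.Surjective aug) {F : Type u} [AddCommGroup F] [Module R F]
    (z : BalTensor T R K F) : ∃ y : Fin a → F, z = ∑ i, btmul T R (aug (Pi.single i 1)) (y i) := by
  induction z using BalTensor.induction_on with
  | h0 => exact ⟨0, by simp [btmul_zero]⟩
  | h1 x y =>
    obtain ⟨c, rfl⟩ := haug x
    refine ⟨fun i => (c i).unop • y, ?_⟩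
    rw [aug_eq_sum aug c, sum_btmul]
    exact Finset.sum_congr rfl fun i _ => op_smul_btmul T R _ (c i).unop y
  | h2 z w hz hw =>
    obtain ⟨y, rfl⟩ := hz
    obtain ⟨y', rfl⟩ := hw
    exact ⟨y + y', by simp [btmul_add, Finset.sum_add_distrib]⟩

theorem sum_btmul_smul_eq_zero {a b : ℕ} (aug : (Fin a → Rᵐᵒᵖ) →ₗ[Rᵐᵒᵖ] K)
    (D : (Fin b → Rᵐᵒᵖ) →ₗ[Rᵐᵒᵖ] (Fin a → Rᵐᵒᵖ)) (h : ∀ c, aug (D c) = 0) {F : Type u}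
    [AddCommGroup F] [Module R F] (z : Fin b → F) :
    ∑ i, btmul T R (aug (Pi.single i 1)) (∑ j, (D (Pi.single j 1) i).unop • z j) = 0 := by
  have h1 : ∀ i, btmul T R (aug (Pi.single i 1)) (∑ j, (D (Pi.single j 1) i).unop • z j) =
      ∑ j, btmul T R (D (Pi.single j 1) i • aug (Pi.single i 1)) (z j) := fun i => by
    rw [btmul_sum]
    exact Finset.sum_congr rfl fun j _ => (op_smul_btmul T R _ _ _).symm
  rw [Finset.sum_congr rfl fun i _ => h1 i, Finset.sum_comm]
  refine Finset.sum_eq_zero fun j _ => ?_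
  rw [← sum_btmul, ← aug_eq_sum, h]
  exact DFunLike.congr_fun (map_zero (btmulHom T R)) (z j)

variable [SMulCommClass T Rᵐᵒᵖ K]

/-- Right exactness of the tensor product, by characters. One that kills the combinations of
relations is a map from `(Rᵐᵒᵖ)^a` to `Dual R F` vanishing on the relations of `K`. It descends to
`K`, hence to a character of `K ⊗_R F`, and so kills `y`. -/
theorem exists_of_sum_btmul_eq_zero {a b : ℕ} {aug : (Fin a → Rᵐᵒᵖ) →ₗ[Rᵐᵒᵖ] K}
    {D : (Fin b → Rᵐᵒᵖ) →ₗ[Rᵐᵒᵖ] (Fin a → Rᵐᵒᵖ)} (haug : Function.Surjective aug)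
    (hex : Function.Exact D aug) {F : Type u} [AddCommGroup F] [Module R F] (y : Fin a → F)
    (hy : ∑ i, btmul T R (aug (Pi.single i 1)) (y i) = 0) :
    ∃ z : Fin b → F, ∀ i, y i = ∑ j, (D (Pi.single j 1) i).unop • z j := by
  let H : (Fin b → F) →+ (Fin a → F) :=
    AddMonoidHom.mk' (fun z i => ∑ j, (D (Pi.single j 1) i).unop • z j) fun z w => by
      ext i
      simp [Finset.sum_add_distrib]
  suffices y ∈ H.range by
    obtain ⟨z, rfl⟩ := this
    exact ⟨z, fun i => rfl⟩
  by_contra hn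
  obtain ⟨θ, hθ, hθy⟩ := exists_character_of_notMem H.range hn
  let θi : Fin a → Dual R F := fun i => θ.comp (AddMonoidHom.single (fun _ => F) i)
  have hθi : ∀ w, θ w = ∑ i, θi i (w i) := fun w => by
    conv_lhs => rw [← Finset.univ_sum_single w, map_sum]
    rfl
  let ψ := homFreeEquiv ℤ Rᵐᵒᵖ (Dual R F) a θi
  have hψ : LinearMap.lcomp ℤ (Dual R F) D ψ = 0 := by
    refine (Pi.basisFun Rᵐᵒᵖ (Fin b)).ext fun j => Dual.ext fun z => ?_
    rw [Pi.basisFun_apply, LinearMap.lcomp_apply, homFreeEquiv_apply, Dual.sum_apply]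
    refine Eq.trans ?_ ((hθi _).symm.trans (hθ _ ⟨Pi.single j z, rfl⟩))
    refine Finset.sum_congr rfl fun i _ => ?_
    rw [Dual.smul_apply]
    congr 1
    change _ = ∑ l, (D (Pi.single l 1) i).unop • (Pi.single j z : Fin b → F) l
    rw [Finset.sum_eq_single j]
    · simp
    · intro l _ hl
      simp [Pi.single_eq_of_ne hl]
    · simp
  obtain ⟨χ, hχ⟩ := (exact_lcomp hex haug ψ).1 hψ
  have h0 := congrArg (uncurry (T := T) χ) hy
  rw [map_zero, map_sum] at h0
  refine hθy ((hθi y).trans (Eq.trans ?_ h0))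
  refine Finset.sum_congr rfl fun i _ => ?_
  have : χ (aug (Pi.single i 1)) = θi i :=
    (LinearMap.congr_fun hχ _).trans (homFreeEquiv_single (A := ℤ) θi i)
  rw [uncurry_btmul, this]

variable {J : Type u} (F : J → Type u) [∀ j, AddCommGroup (F j)] [∀ j, Module R (F j)]

variable (T R K) in
/-- The comparison map from `K ⊗_R ∏ F_j` to `∏ K ⊗_R F_j`. -/
def balTensorPi : BalTensor T R K (∀ j, F j) →ₗ[T] ∀ j, BalTensor T R K (F j) :=
  LinearMap.pi fun j => BalTensor.map T K (LinearMap.proj j)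

/-- One finite list of generators and one finite list of relations of `K` serve every index `j`, so
coefficients chosen for each `j` can be collected into elements of the product. -/
theorem balTensorPi_bijective (hK : IsFP Rᵐᵒᵖ 1 K) : Function.Bijective (balTensorPi T R K F) := by
  obtain ⟨rank, aug, diff, haug, h0, -⟩ := hK.isFinitelyNPresented
  have h0 := h0 one_pos
  have hsum : ∀ (y : Fin (rank 0) → ∀ j, F j) j,
      balTensorPi T R K F (∑ i, btmul T R (aug (Pi.single i 1)) (y i)) j =
        ∑ i, btmul T R (aug (Pi.single i 1)) (y i j) := fun y j =>
    map_sum (BalTensor.map T K (LinearMap.proj (R := R) (φ := F) j)) _ _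
  constructor
  · rw [injective_iff_map_eq_zero]
    intro z hz
    obtain ⟨y, rfl⟩ := exists_eq_sum_btmul aug haug z
    choose w hw using fun j => exists_of_sum_btmul_eq_zero (T := T) haug h0 (fun i => y i j)
      ((hsum y j).symm.trans (congrFun hz j))
    have hy : y = fun i => ∑ l, (diff 0 (Pi.single l 1) i).unop • fun j => w j l := by
      ext i j
      rw [hw j i, Finset.sum_apply]
      rfl
    rw [hy]
    exact sum_btmul_smul_eq_zero aug (diff 0) h0.apply_apply_eq_zero _
  · intro z
    choose y hy using fun j => exists_eq_sum_btmul aug haug (z j)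
    exact ⟨_, funext fun j => (hsum (fun i j => y j i) j).trans (hy j).symm⟩

theorem eq_zero_of_forall_map_proj (hK : IsFP Rᵐᵒᵖ 1 K) (z : BalTensor T R K (∀ j, F j))
    (h : ∀ j, BalTensor.map T K (LinearMap.proj (R := R) (φ := F) j) z = 0) : z = 0 :=
  (injective_iff_map_eq_zero _).1 (balTensorPi_bijective F hK).1 z (funext h)

variable (T R K) in
open Classical in
/-- The comparison map from `⨁ K ⊗_R F_j` to `K ⊗_R ⨁ F_j`. -/
noncomputable def balTensorDirectSum : (⨁ j, BalTensor T R K (F j)) →ₗ[T] BalTensor T R K (⨁ j, F j) :=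
  DirectSum.toModule T J _ fun j => BalTensor.map T K (DirectSum.lof R J F j)

open Classical in
theorem balTensorDirectSum_bijective : Function.Bijective (balTensorDirectSum T R K F) := by
  have hΨ : ∀ j, BalTensor.map T K (DirectSum.component R J F j) ∘ₗ balTensorDirectSum T R K F =
      DirectSum.component T J (fun j => BalTensor T R K (F j)) j := by
    intro j
    refine DirectSum.linearMap_ext T fun l => BalTensor.linearMap_ext fun x y => ?_
    simp only [LinearMap.comp_apply, balTensorDirectSum, DirectSum.toModule_lof,
      BalTensor.map_btmul]
    rw [DirectSum.component.of, DirectSum.component.of]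
    split_ifs with h
    · subst h
      rfl
    · exact btmul_zero T R x
  constructor
  · rw [injective_iff_map_eq_zero]
    intro z hz
    refine DFinsupp.ext fun j => (LinearMap.congr_fun (hΨ j) z).symm.trans ?_
    rw [LinearMap.comp_apply, hz, map_zero]
    rfl
  · rw [← LinearMap.range_eq_top, eq_top_iff]
    rintro z -
    induction z using BalTensor.induction_on with
    | h0 => exact Submodule.zero_mem _
    | h1 x y =>
      induction y using DirectSum.induction_on with
      | zero =>
        rw [btmul_zero]
        exact Submodule.zero_mem _
      | of j y => exact ⟨DirectSum.lof T J _ j (btmul T R x y), DirectSum.toModule_lof T j _⟩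
      | add y z hy hz =>
        rw [btmul_add]
        exact Submodule.add_mem _ hy hz
    | h2 z w hz hw => exact Submodule.add_mem _ hz hw

end Products

/-! ### Products and direct sums of `(n, d)`-flat modules. -/

section Flat

variable {R : Type u} [Ring R] {n d : ℕ}

theorem IsNDFlat.of_retract {M N : Type u} [AddCommGroup M] [Module R M] [AddCommGroup N]
    [Module R N] (hN : IsNDFlat R n d N) (i : M →ₗ[R] N) (p : N →ₗ[R] M)
    (h : p ∘ₗ i = LinearMap.id) : IsNDFlat R n d M :=
  (isNDFlat_iff_dual M).2 (((isNDFlat_iff_dual N).1 hN).of_retract (Dual.map p) (Dual.map i)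
    (LinearMap.ext fun φ => Dual.ext fun y => congrArg φ (LinearMap.congr_fun h y)))

variable {J : Type u} (N : J → Type u) [∀ j, AddCommGroup (N j)] [∀ j, Module R (N j)]

open Classical in
-- The character module of a direct sum is the product of the character modules; realising it as a
-- retract of that product suffices.
theorem IsNDFlat.directSum (hn : d ≤ n) (h : ∀ j, IsNDFlat R n d (N j)) :
    IsNDFlat R n d (⨁ j, N j) := by
  rw [isNDFlat_iff_dual]
  refine (IsNDInjective.pi hn fun j => (isNDFlat_iff_dual (N j)).1 (h j)).of_retract
    (LinearMap.pi fun j => Dual.map (DirectSum.lof R J N j))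
    { toFun := fun φ => DirectSum.toAddMonoid fun j => (φ j : N j →+ QZ)
      map_add' := fun φ ψ => DirectSum.addHom_ext fun j y => ?_
      map_smul' := fun r φ => DirectSum.addHom_ext fun j y => ?_ }
    (LinearMap.ext fun φ => DirectSum.addHom_ext fun j y => ?_)
  · exact (DirectSum.toAddMonoid_of _ j y).trans (congrArg₂ (· + ·)
      (DirectSum.toAddMonoid_of (fun j => (φ j : N j →+ QZ)) j y)
      (DirectSum.toAddMonoid_of (fun j => (ψ j : N j →+ QZ)) j y)).symm
  · refine (DirectSum.toAddMonoid_of _ j y).trans ?_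
    refine Eq.trans ?_ (congrArg (DirectSum.toAddMonoid fun j => (φ j : N j →+ QZ))
      ((DirectSum.lof R J N j).map_smul r.unop y))
    exact (DirectSum.toAddMonoid_of (fun j => (φ j : N j →+ QZ)) j (r.unop • y)).symm
  · exact DirectSum.toAddMonoid_of _ j y

/-- An additive map is injective iff every character of its source extends to its target, and
characters of `W ⊗_R N` are maps `W → Dual R N`. -/
theorem mapLeft_injective_iff {W G : Type u} [AddCommGroup W] [Module Rᵐᵒᵖ W] [AddCommGroup G]
    [Module Rᵐᵒᵖ G] (ι : W →ₗ[Rᵐᵒᵖ] G) (N : Type u) [AddCommGroup N] [Module R N] :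
    Function.Injective (BalTensor.mapLeft (F := N) ι) ↔
      ∀ φ : W →ₗ[Rᵐᵒᵖ] Dual R N, ∃ ψ : G →ₗ[Rᵐᵒᵖ] Dual R N, ψ ∘ₗ ι = φ := by
  constructor
  · intro h φ
    obtain ⟨η, hη⟩ := exists_addMonoidHom_extension _ h (uncurry φ)
    exact ⟨curry η, LinearMap.ext fun w => Dual.ext fun y =>
      DFunLike.congr_fun hη (btmul ℤ R w y)⟩
  · intro h z w hzw
    refine eq_of_forall_character fun θ => ?_
    obtain ⟨ψ, hψ⟩ := h (curry θ)
    have : (uncurry ψ).comp (BalTensor.mapLeft ι) = θ := BalTensor.addHom_ext fun w y =>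
      DFunLike.congr_fun (LinearMap.congr_fun hψ w) y
    rw [← this, AddMonoidHom.comp_apply, hzw, AddMonoidHom.comp_apply]

/-- In degree one the claim is that tensoring the inclusion of the syzygy with the product stays
injective. The syzygy is finitely presented, so its tensor product with the product is detected on
the factors. This needs `k + 2` steps of presentation, supplied by `d + 1 < n`. -/
theorem extVanishes_dual_pi {k : ℕ} : ∀ {U : Type u} [AddCommGroup U] [Module Rᵐᵒᵖ U]
    (_ : IsFP Rᵐᵒᵖ (k + 2) U) (_ : ∀ j, ExtVanishes Rᵐᵒᵖ U (Dual R (N j)) (k + 1)),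
    ExtVanishes Rᵐᵒᵖ U (Dual R (∀ j, N j)) (k + 1) := by
  induction k with
  | zero =>
    rintro U _ _ ⟨r, f, hf, hU⟩ h
    rw [extVanishes_one_iff_ker _ hf, ← mapLeft_injective_iff, injective_iff_map_eq_zero]
    intro z hz
    refine eq_zero_of_forall_map_proj N hU z fun j => ?_
    refine (mapLeft_injective_iff _ (N j)).2
      ((extVanishes_one_iff_ker (Dual R (N j)) hf).1 (h j)) ?_
    have hsq : (BalTensor.mapLeft (LinearMap.ker f).subtype).comp
        (BalTensor.map ℤ (LinearMap.ker f) (LinearMap.proj (R := R) (φ := N) j)).toAddMonoidHom =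
        (BalTensor.map ℤ _ (LinearMap.proj (R := R) (φ := N) j)).toAddMonoidHom.comp
          (BalTensor.mapLeft (LinearMap.ker f).subtype) :=
      BalTensor.addHom_ext fun x y => rfl
    refine (DFunLike.congr_fun hsq z).trans ?_
    rw [AddMonoidHom.comp_apply, hz, map_zero]
    exact (map_zero (BalTensor.mapLeft (LinearMap.ker f).subtype)).symm
  | succ k ih =>
    rintro U _ _ ⟨r, f, hf, hU⟩ h
    rw [extVanishes_succ_iff_ker _ hf (by omega)]
    exact ih hU fun j => (extVanishes_succ_iff_ker _ hf (by omega)).1 (h j)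

theorem IsNDFlat.pi (hn : d + 1 < n) (h : ∀ j, IsNDFlat R n d (N j)) :
    IsNDFlat R n d (∀ j, N j) := by
  rw [isNDFlat_iff_dual, isNDInjective_iff]
  exact fun U _ _ hU => extVanishes_dual_pi N (hU.mono hn) fun j =>
    isNDInjective_iff.1 ((isNDFlat_iff_dual (N j)).1 (h j)) U hU

end Flat

/-! ### Retracts of modules `K ⊗_R F`, and the equivalences of part (b). -/

section RelFlat

variable {S R : Type u} [Ring S] [Ring R] {n d : ℕ} {C K : Type u}
  [AddCommGroup C] [Module S C] [Module Rᵐᵒᵖ C] [SMulCommClass S Rᵐᵒᵖ C]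
  [AddCommGroup K] [Module S K] [Module Rᵐᵒᵖ K] [SMulCommClass S Rᵐᵒᵖ K]

theorem IsSpecialSemidualizing.exists_presentation_right (hK : IsSpecialSemidualizing S R d C K)
    (hd : 1 ≤ d) {F : Type u} [AddCommGroup F] [Module R F] (hF : IsNDFlat R n d F) :
    ∃ P : FiniteFreeResolution S K,
      (∀ χ : Dual R F, ∃ f : Fin (P.rank 0) → (K →ₗ[Rᵐᵒᵖ] Dual R F),
        ∑ i, f i (P.aug (Pi.single i 1)) = χ) ∧
      ∀ f : Fin (P.rank 0) → (K →ₗ[Rᵐᵒᵖ] Dual R F), ∑ i, f i (P.aug (Pi.single i 1)) = 0 →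
        ∃ g : Fin (P.rank 1) → (K →ₗ[Rᵐᵒᵖ] Dual R F),
          ∀ i y, f i y = ∑ j, g j (P.diff 0 (Pi.single j 1) i • y) := by
  obtain ⟨P⟩ := hK.left_syzygy.nonempty_resolution
  obtain ⟨Q⟩ := hK.right_syzygy.nonempty_resolution
  have hI := (isNDFlat_iff_dual F).1 hF
  refine ⟨P, exists_presentation (d := d) P (fun m => Q.isFP m) hK.semidualizing.left_ext ?_
    (fun i hi => hK.right_syzygy.extVanishes hd hI hi)
    fun V _ _ hV => isNDInjective_iff.1 hI V (hV n)⟩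
  -- Here `A = Rᵐᵒᵖ`, whereas the homothety is stated for `R`.
  exact hK.semidualizing.right_homothety.comp MulOpposite.unop_bijective

/-- This is bijectivity of `F → Hom_S(K, K ⊗_R F)`, dual to the presentation of `Dual R F`:
exactness in the middle of the presentation gives existence, and surjectivity onto `Dual R F` gives
uniqueness. -/
theorem IsSpecialSemidualizing.existsUnique_btmul (hK : IsSpecialSemidualizing S R d C K)
    (hd : 1 ≤ d) {F : Type u} [AddCommGroup F] [Module R F] (hF : IsNDFlat R n d F)
    (h : K →ₗ[S] BalTensor S R K F) : ∃! y : F, ∀ x, h x = btmul S R x y := by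
  obtain ⟨P, hsurj, hker⟩ := hK.exists_presentation_right hd hF
  have hext : ∀ h' : K →ₗ[S] BalTensor S R K F,
      (∀ i, h (P.aug (Pi.single i 1)) = h' (P.aug (Pi.single i 1))) → h = h' := fun h' hh =>
    LinearMap.ext fun x => by
      obtain ⟨c, rfl⟩ := P.aug_surjective x
      simp only [aug_eq_sum P.aug c, map_sum, map_smul, hh]
  let H : F →+ (Fin (P.rank 0) → BalTensor S R K F) :=
    AddMonoidHom.mk' (fun y i => btmul S R (P.aug (Pi.single i 1)) y) fun y z =>
      funext fun i => btmul_add S R _ y z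
  have hmem : (fun i => h (P.aug (Pi.single i 1))) ∈ H.range := by
    by_contra hn
    obtain ⟨θ, hθ, hθy⟩ := exists_character_of_notMem H.range hn
    let θi : Fin (P.rank 0) → (BalTensor S R K F →+ QZ) := fun i =>
      θ.comp (AddMonoidHom.single (fun _ => BalTensor S R K F) i)
    have hθi : ∀ w, θ w = ∑ i, θi i (w i) := fun w => by
      conv_lhs => rw [← Finset.univ_sum_single w, map_sum]
      rfl
    -- A character killing all tuples `k_i ⊗ y` satisfies the hypothesis of `hker`, so it is a
    -- combination of relations among the `k_i`. The elements `h k_i` satisfy these relations too,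
    -- so the character kills them, a contradiction.
    obtain ⟨g, hg⟩ := hker (fun i => curry (θi i)) (Dual.ext fun y => by
      rw [Dual.sum_apply]
      exact (hθi _).symm.trans (hθ _ ⟨y, rfl⟩))
    have hgθ : ∀ i z, θi i z = ∑ j, uncurry (g j) (P.diff 0 (Pi.single j 1) i • z) := by
      intro i z
      induction z using BalTensor.induction_on with
      | h0 => simp
      | h1 x y =>
        refine (DFunLike.congr_fun (hg i x) y).trans ?_
        rw [Dual.sum_apply]
        rfl
      | h2 z w hz hw => simp only [map_add, smul_add, hz, hw, Finset.sum_add_distrib]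
    refine hθy ((hθi _).trans ?_)
    simp only [hgθ]
    rw [Finset.sum_comm]
    refine Finset.sum_eq_zero fun j _ => ?_
    have h0 := congrArg h (P.exact_zero.apply_apply_eq_zero (Pi.single j 1))
    rw [aug_eq_sum P.aug, map_sum, map_zero] at h0
    simp only [map_smul] at h0
    rw [← map_sum, h0, map_zero]
  obtain ⟨y, hy⟩ := hmem
  refine ⟨y, ?_, fun z hz => ?_⟩
  · have := hext { toFun := fun x => btmul S R x y
                   map_add' := fun x w => add_btmul S R x w y
                   map_smul' := fun s x => rfl } fun i => (congrFun hy i).symm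
    exact fun x => LinearMap.congr_fun this x
  -- Each character of `F` is a sum of values at the `k_i`, so it sees `y` only through the elements
  -- `k_i ⊗ y`.
  · refine eq_of_forall_character fun χ => ?_
    obtain ⟨f, hf⟩ := hsurj χ
    have hχ : ∀ w, χ w = ∑ i, uncurry (T := S) (f i) (btmul S R (P.aug (Pi.single i 1)) w) :=
      fun w => (DFunLike.congr_fun hf w).symm.trans (Dual.sum_apply _ _ w)
    rw [hχ, hχ]
    refine Finset.sum_congr rfl fun i _ => ?_
    rw [← hz]
    exact congrArg _ (congrFun hy i).symm

/-- The idempotent of `K ⊗_R F` has the form `K ⊗ Φ`, where uniqueness makes `Φ` linear and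
idempotent. Then `M` and `K ⊗_R F'`, with `F'` the image of `Φ`, split the same idempotent and are
therefore isomorphic. -/
theorem IsRelNDFlat.of_retract (hK : IsSpecialSemidualizing S R d C K)
    (hd : 1 ≤ d) {M N : Type u} [AddCommGroup M] [Module S M] [AddCommGroup N] [Module S N]
    (hN : IsRelNDFlat S R K n d N) (i : M →ₗ[S] N) (p : N →ₗ[S] M)
    (hpi : p ∘ₗ i = LinearMap.id) : IsRelNDFlat S R K n d M := by
  obtain ⟨F, _, _, hF, ⟨E⟩⟩ := hN
  let i' : M →ₗ[S] BalTensor S R K F := E.toLinearMap ∘ₗ i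
  let p' : BalTensor S R K F →ₗ[S] M := p ∘ₗ E.symm.toLinearMap
  have hpi' : ∀ m, p' (i' m) = m := fun m => by
    simpa [i', p'] using LinearMap.congr_fun hpi m
  let h : F → K →ₗ[S] BalTensor S R K F := fun y =>
    { toFun := fun x => i' (p' (btmul S R x y))
      map_add' := fun x w => by rw [add_btmul, map_add, map_add]
      map_smul' := fun s x => by rw [smul_btmul, map_smul, map_smul]; rfl }
  choose φ hφ hφu using fun y => hK.existsUnique_btmul hd hF (h y)
  have hφ : ∀ y x, i' (p' (btmul S R x y)) = btmul S R x (φ y) := hφ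
  let Φ : F →ₗ[R] F :=
    { toFun := φ
      map_add' := fun y z => (hφu _ _ fun x => by
        change i' (p' (btmul S R x (y + z))) = _
        rw [btmul_add, map_add, map_add, hφ, hφ, btmul_add]).symm
      map_smul' := fun r y => (hφu _ _ fun x => by
        change i' (p' (btmul S R x (r • y))) = _
        rw [← op_smul_btmul, hφ, op_smul_btmul]
        rfl).symm }
  have hΦ : ∀ y, Φ (Φ y) = Φ y := fun y => (hφu _ _ fun x => by
    change i' (p' (btmul S R x (φ y))) = btmul S R x (φ y)
    rw [← hφ, hpi']).symm
  let F' : Submodule R F := LinearMap.eqLocus Φ LinearMap.id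
  let π : F →ₗ[R] F' := Φ.codRestrict F' hΦ
  have hπ : π ∘ₗ F'.subtype = LinearMap.id := LinearMap.ext fun y => Subtype.ext y.2
  let ι := BalTensor.map S K F'.subtype
  let ρ := BalTensor.map S K π
  have hρι : ρ ∘ₗ ι = LinearMap.id := BalTensor.linearMap_ext fun x y =>
    congrArg (btmul S R x) (LinearMap.congr_fun hπ y)
  have hιρ : ι ∘ₗ ρ = i' ∘ₗ p' := BalTensor.linearMap_ext fun x y => (hφ y x).symm
  have hei : (i' ∘ₗ p') ∘ₗ ι = ι := by
    rw [← hιρ, LinearMap.comp_assoc, hρι, LinearMap.comp_id]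
  refine ⟨F', inferInstance, inferInstance, hF.of_retract F'.subtype π hπ, ⟨?_⟩⟩
  refine LinearEquiv.ofLinearMap (ρ ∘ₗ i') (p' ∘ₗ ι) ?_ ?_
  · rw [LinearMap.comp_assoc, ← LinearMap.comp_assoc ι p' i', hei, hρι]
  · refine LinearMap.ext fun m => ?_
    have := LinearMap.congr_fun hιρ (i' m)
    simp only [LinearMap.comp_apply, hpi'] at this
    simp only [LinearMap.comp_apply, this, hpi', LinearMap.id_apply]

variable {J : Type u} {M : J → Type u} [∀ j, AddCommGroup (M j)] [∀ j, Module S (M j)]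

theorem IsRelNDFlat.pi (hK : IsFP Rᵐᵒᵖ 1 K) (hn : d + 1 < n)
    (h : ∀ j, IsRelNDFlat S R K n d (M j)) : IsRelNDFlat S R K n d (∀ j, M j) := by
  choose F i1 i2 hF E using h
  exact ⟨∀ j, F j, inferInstance, inferInstance, IsNDFlat.pi F hn hF,
    ⟨(LinearEquiv.piCongrRight fun j => (E j).some).trans
      (LinearEquiv.ofBijective _ (balTensorPi_bijective (T := S) F hK)).symm⟩⟩

open Classical in
theorem IsRelNDFlat.directSum (hn : d ≤ n) (h : ∀ j, IsRelNDFlat S R K n d (M j)) :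
    IsRelNDFlat S R K n d (⨁ j, M j) := by
  choose F i1 i2 hF E using h
  exact ⟨⨁ j, F j, inferInstance, inferInstance, IsNDFlat.directSum F hn hF,
    ⟨(DFinsupp.mapRange.linearEquiv fun j => (E j).some).trans
      (LinearEquiv.ofBijective _ (balTensorDirectSum_bijective (T := S) (K := K) F))⟩⟩

theorem isRelNDFlat_tfae (hd : 1 ≤ d) (hn : d + 1 < n)
    (hK : IsSpecialSemidualizing S R d C K) (M : J → Type u)
    [∀ j, AddCommGroup (M j)] [∀ j, Module S (M j)] :
    [∀ j, IsRelNDFlat S R K n d (M j), IsRelNDFlat S R K n d (∀ j, M j),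
      IsRelNDFlat S R K n d (⨁ j, M j)].TFAE := by
  classical
  have hfp : IsFP Rᵐᵒᵖ 1 K := by
    obtain ⟨Q⟩ := hK.right_syzygy.nonempty_resolution
    exact Q.isFP 1
  tfae_have 1 → 2 := IsRelNDFlat.pi hfp hn
  tfae_have 1 → 3 := IsRelNDFlat.directSum (by omega)
  tfae_have 2 → 1 := fun h j => h.of_retract hK hd _ _ (proj_comp_single_eq_id M j)
  tfae_have 3 → 1 := fun h j => h.of_retract hK hd _ _ (component_comp_lof_eq_id M j)
  tfae_finish

end RelFlat

end SpecialSemidualizing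

theorem mainTheorem9 (S R : Type u) [Ring S] [Ring R] (n d : ℕ) (hd : 1 ≤ d) (hn : d + 1 < n)
    (C K : Type u)
    [AddCommGroup C] [Module S C] [Module Rᵐᵒᵖ C] [SMulCommClass S Rᵐᵒᵖ C]
    [AddCommGroup K] [Module S K] [Module Rᵐᵒᵖ K] [SMulCommClass S Rᵐᵒᵖ K]
    (hK : SpecialSemidualizing.IsSpecialSemidualizing S R d C K) (J : Type u) :
    (∀ (M : J → Type u) [∀ j, AddCommGroup (M j)] [∀ j, Module R (M j)],
      [∀ j, SpecialSemidualizing.IsRelNDInjective S R K n d (M j),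
        SpecialSemidualizing.IsRelNDInjective S R K n d (∀ j, M j),
        SpecialSemidualizing.IsRelNDInjective S R K n d (⨁ j, M j)].TFAE) ∧
    (∀ (M : J → Type u) [∀ j, AddCommGroup (M j)] [∀ j, Module S (M j)],
      [∀ j, SpecialSemidualizing.IsRelNDFlat S R K n d (M j),
        SpecialSemidualizing.IsRelNDFlat S R K n d (∀ j, M j),
        SpecialSemidualizing.IsRelNDFlat S R K n d (⨁ j, M j)].TFAE) :=
  ⟨fun M _ _ => SpecialSemidualizing.isRelNDInjective_tfae hd hn hK M,
    fun M _ _ => SpecialSemidualizing.isRelNDFlat_tfae hd hn hK M⟩
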